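/- Let $d\ge 3$ be an integer, $p\in(d,\infty)$, and write $s_r:=-1+\frac dr$. Fix a non-negative radial $\varphi\in C^\infty(\mathbb R^d)$ supported in $\{\frac34\le|\xi|\le\frac83\}$ with $\sum_{j\in\mathbb Z}\varphi(2^{-j}\xi)=1$ for $\xi\ne0$, and put $\dot\Delta_jf=\varphi(2^{-j}D)f$ for tempered distributions $f$ on $\mathbb R^d$ with values in $\mathbb R^d$. For $r,q\in[1,\infty]$ and $s<d/r$, the space $\dot B^{s}_{r,q}(\mathbb R^d)$ consists of those $f$ for which $\|f\|_{\dot B^s_{r,q}}:=\big\|(2^{js}\|\dot\Delta_jf\|_{L^r})_{j\in\mathbb Z}\big\|_{\ell^q}<\infty$ and $\sum_{j\in\mathbb Z}\dot\Delta_jf=f$ in the sense of tempered distributions. There exist $p_2\in(p,\infty)$, $\delta_2\in(0,-s_{p_2})$, $\gamma_1,\gamma_2>0$, each depending only on $d$ and $p$, and $C>0$, depending only on $d$, $p$ and $\varphi$, such that for each divergence-free vector field $g\in\dot B^{s_p}_{p,\infty}(\mathbb R^d)$ and each $N>0$ there exist divergence-free vector fields $\bar g^N\in\dot B^{s_{p_2}+\delta_2}_{p_2,p_2}(\mathbb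 R^d)\cap\dot B^{s_p}_{p,\infty}(\mathbb R^d)$ and $\tilde g^N\in L^2(\mathbb R^d)\cap\dot B^{s_p}_{p,\infty}(\mathbb R^d)$ with $$g=\tilde g^N+\bar g^N,$$ $$\|\tilde g^N\|_{L^2}\le CN^{-\gamma_2}\|g\|_{\dot B^{s_p}_{p,\infty}},\qquad \|\bar g^N\|_{\dot B^{s_{p_2}+\delta_2}_{p_2,p_2}}\le CN^{\gamma_1}\|g\|_{\dot B^{s_p}_{p,\infty}},$$ and $$\|\tilde g^N\|_{\dot B^{s_p}_{p,\infty}},\ \|\bar g^N\|_{\dot B^{s_p}_{p,\infty}}\le C\|g\|_{\dot B^{s_p}_{p,\infty}}.$$ -/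

import Mathlib

open scoped SchwartzMap ENNReal LineDeriv

noncomputable section

/-- Tempered distributions on `ℝ^d` with values in `ℂ^d`; the `ℝ^d`-valued ones are singled out by
`IsRealValued`. -/
abbrev VectorDistribution (d : ℕ) : Type :=
  𝓢'(EuclideanSpace ℝ (Fin d), EuclideanSpace ℂ (Fin d))

/-- The distribution takes values in `ℝ^d`: every component is real on real test functions. -/
def IsRealValued {d : ℕ} (f : VectorDistribution d) : Prop :=
  ∀ u : 𝓢(EuclideanSpace ℝ (Fin d), ℂ), (∀ x, (u x).im = 0) → ∀ i, (f u i).im = 0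

/-- `div f = ∑ᵢ ∂ᵢ fᵢ = 0` in the sense of distributions. -/
def IsDivFree {d : ℕ} (f : VectorDistribution d) : Prop :=
  ∀ u : 𝓢(EuclideanSpace ℝ (Fin d), ℂ),
    ∑ i : Fin d, (∂_{EuclideanSpace.single i (1 : ℝ)} f) u i = 0

/-- A smooth, non-negative, radial function supported in `3/4 ≤ |ξ| ≤ 8/3` whose dyadic dilates sum
to one away from the origin. -/
structure IsLittlewoodPaley {d : ℕ} (φ : EuclideanSpace ℝ (Fin d) → ℝ) : Prop where
  smooth : ContDiff ℝ (⊤ : ℕ∞) φ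
  nonneg : ∀ ξ, 0 ≤ φ ξ
  radial : ∀ ξ η, ‖ξ‖ = ‖η‖ → φ ξ = φ η
  support : ∀ ξ, φ ξ ≠ 0 → 3 / 4 ≤ ‖ξ‖ ∧ ‖ξ‖ ≤ 8 / 3
  partition : ∀ ξ, ξ ≠ 0 → HasSum (fun j : ℤ => φ ((2 : ℝ) ^ (-j) • ξ)) 1

/-- The Littlewood–Paley projector `Δ_j f = φ(2⁻ʲ D) f` with `D = -i∇`. Mathlib's Fourier transform
uses the character `exp (-2πi x·ξ)`, so `D` has the symbol `2π ξ`. -/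
def lpProj {d : ℕ} (φ : EuclideanSpace ℝ (Fin d) → ℝ) (j : ℤ) (f : VectorDistribution d) :
    VectorDistribution d :=
  TemperedDistribution.fourierMultiplierCLM (EuclideanSpace ℂ (Fin d))
    (fun ξ => (φ ((2 : ℝ) ^ (-j) • (2 * Real.pi) • ξ) : ℂ)) f

/-- The `L^p` norm (`1 ≤ p ≤ ∞`) of a distribution: the norm of the `L^p` function that represents
it, and `∞` if there is none. -/
def distLpNorm {d : ℕ} (p : ℝ≥0∞) (f : VectorDistribution d) : ℝ≥0∞ :=
  ⨅ (F : EuclideanSpace ℝ (Fin d) → EuclideanSpace ℂ (Fin d))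
    (_ : MeasureTheory.MemLp F p MeasureTheory.volume)
    (_ : ∀ u : 𝓢(EuclideanSpace ℝ (Fin d), ℂ), f u = ∫ x, u x • F x),
    MeasureTheory.eLpNorm F p MeasureTheory.volume

/-- The `ℓ^q(ℤ)` norm (`0 < q ≤ ∞`) of a sequence in `[0, ∞]`. -/
def seqNorm (q : ℝ≥0∞) (a : ℤ → ℝ≥0∞) : ℝ≥0∞ :=
  if q = ∞ then ⨆ j, a j else (∑' j, a j ^ q.toReal) ^ (1 / q.toReal)

/-- The homogeneous Besov norm of `Ḃ^s_{p,q}`. -/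
def besovNorm {d : ℕ} (φ : EuclideanSpace ℝ (Fin d) → ℝ) (s : ℝ) (p q : ℝ≥0∞)
    (f : VectorDistribution d) : ℝ≥0∞ :=
  seqNorm q fun j => ENNReal.ofReal ((2 : ℝ) ^ ((j : ℝ) * s)) * distLpNorm p (lpProj φ j f)

/-- Membership in `Ḃ^s_{p,q}` for `s < d/p`: the norm is finite and `∑_j Δ_j f` converges to `f` in
the space of tempered distributions. -/
def MemBesov {d : ℕ} (φ : EuclideanSpace ℝ (Fin d) → ℝ) (s : ℝ) (p q : ℝ≥0∞)
    (f : VectorDistribution d) : Prop :=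
  besovNorm φ s p q f < ∞ ∧ HasSum (fun j : ℤ => lpProj φ j f) f

/-- The critical regularity `s_p = -1 + d/p`. -/
def critReg (d : ℕ) (p : ℝ) : ℝ := -1 + d / p

end

open scoped NNReal
open MeasureTheory FourierTransform

/-!
By Bernstein's inequality the block `Δ_j g` has size `2^j` in `L^∞` and `2^(-j s_p)` in `L^p`. Fix
`J` with `2^J ≈ N`. The blocks with `j < J` go to the regular part. For `j ≥ J` the block is
truncated at height `2^(j - κ(j - J))`: the large values have finite measure and go to the `L²`
part, the small ones go to the regular part. The `L²` norms of the large values decay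
geometrically in `j - J` when `κ < (d - 2)/(p - 2)`. Interpolating the small values between `L^p`
and `L^∞`, their weighted `L^q` norms decay in `|j - J|` when `κ` is large compared with `δ`, so
`δ` has to be small. Truncation destroys the frequency localization and the divergence-free
condition; applying to both pieces the Leray projector localized near frequency `2^j` restores
them, leaves the sum `Δ_j g` unchanged and is bounded on every `L^r`.
-/

section Kernel

variable {E V : Type*} [NormedAddCommGroup E] [InnerProductSpace ℝ E] [FiniteDimensional ℝ E]
  [MeasurableSpace E] [BorelSpace E] [NormedAddCommGroup V] [NormedSpace ℂ V]

theorem fourier_smulLeftCLM_fourierInv_apply (m u : 𝓢(E, ℂ)) (y : E) :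
    𝓕 (SchwartzMap.smulLeftCLM ℂ (⇑m) (𝓕⁻ u)) y = ∫ x, 𝓕 m (y - x) * u x := by
  set P := SchwartzMap.convolution (ContinuousLinearMap.mul ℂ ℂ) (𝓕 m) u
  have hP : SchwartzMap.smulLeftCLM ℂ (⇑m) (𝓕⁻ u) = 𝓕⁻ P := by
    ext ξ
    have hm : 𝓕 (𝓕 m) (-ξ) = m ξ := by
      simpa using (DFunLike.congr_fun (SchwartzMap.fourierInv_apply_eq (𝓕 m)) ξ).symm
    simp [P, SchwartzMap.fourierInv_apply_eq, SchwartzMap.fourier_convolution,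
      SchwartzMap.smulLeftCLM_apply_apply m.hasTemperateGrowth, hm]
  rw [hP, FourierTransform.fourier_fourierInv_eq, SchwartzMap.convolution_apply,
    convolution_mul_swap]

theorem integrable_schwartz_smul (u : 𝓢(E, ℂ)) {p : ℝ≥0∞} (hp : 1 ≤ p) {F : E → V}
    (hF : MemLp F p) : Integrable fun x => u x • F x := by
  have := ENNReal.HolderConjugate.inv_one_sub_inv' hp
  have : ENNReal.HolderTriple (1 - p⁻¹)⁻¹ p 1 := ENNReal.HolderTriple.symm
  exact memLp_one_iff_integrable.1 (hF.smul (u.memLp (1 - p⁻¹)⁻¹ volume))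

theorem lintegral_enorm_mul_sub_le {K : E → ℂ} (hK : AEStronglyMeasurable K) {F : E → V}
    (hF : AEStronglyMeasurable F) {p q : ℝ≥0∞} [p.HolderConjugate q] (x : E) :
    ∫⁻ y, ‖K (y - x) • F y‖ₑ ≤ eLpNorm K q * eLpNorm F p := by
  have hmp : MeasurePreserving (fun y : E => y - x) := measurePreserving_sub_right volume x
  have : ENNReal.HolderTriple q p 1 := ENNReal.HolderTriple.symm
  rw [← eLpNorm_one_eq_lintegral_enorm, ← eLpNorm_comp_measurePreserving hK hmp]
  exact eLpNorm_smul_le_mul_eLpNorm (r := 1) hF (hK.comp_measurePreserving hmp)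

theorem aestronglyMeasurable_kernel_smul {K : E → ℂ} (hK : Continuous K) {F : E → V}
    (hF : AEStronglyMeasurable F) :
    AEStronglyMeasurable (fun z : E × E => K (z.2 - z.1) • F z.2) (volume.prod volume) :=
  (hK.comp (continuous_snd.sub continuous_fst)).aestronglyMeasurable.smul
    (hF.comp_quasiMeasurePreserving Measure.quasiMeasurePreserving_snd)

theorem integrable_smul_kernel_smul (u K : 𝓢(E, ℂ)) {p : ℝ≥0∞} (hp : 1 ≤ p) {F : E → V}
    (hF : MemLp F p) :
    Integrable (fun z : E × E => u z.1 • K (z.2 - z.1) • F z.2) (volume.prod volume) := by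
  have := ENNReal.HolderConjugate.inv_one_sub_inv' hp
  have hm : AEStronglyMeasurable (fun z : E × E => u z.1 • K (z.2 - z.1) • F z.2)
      (volume.prod volume) :=
    (u.continuous.comp continuous_fst).aestronglyMeasurable.smul
      (aestronglyMeasurable_kernel_smul K.continuous hF.1)
  refine ⟨hm, ?_⟩
  rw [hasFiniteIntegral_iff_enorm, lintegral_prod _ hm.enorm]
  calc ∫⁻ x, ∫⁻ y, ‖u x • K (y - x) • F y‖ₑ
      = ∫⁻ x, ‖u x‖ₑ * ∫⁻ y, ‖K (y - x) • F y‖ₑ := by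
        refine lintegral_congr fun x => ?_
        rw [← lintegral_const_mul' _ _ enorm_ne_top]
        exact lintegral_congr fun y => enorm_smul _ _
    _ ≤ ∫⁻ x, ‖u x‖ₑ * (eLpNorm K (1 - p⁻¹)⁻¹ * eLpNorm F p) := by
        gcongr with x
        exact lintegral_enorm_mul_sub_le K.continuous.aestronglyMeasurable hF.1 x
    _ = (∫⁻ x, ‖u x‖ₑ) * (eLpNorm K (1 - p⁻¹)⁻¹ * eLpNorm F p) :=
        lintegral_mul_const _ u.continuous.enorm.measurable
    _ < ∞ := by
        have hu : ∫⁻ x, ‖u x‖ₑ < ∞ := (u.integrable (μ := volume)).2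
        have hK : eLpNorm K (1 - p⁻¹)⁻¹ volume < ∞ := (K.memLp (1 - p⁻¹)⁻¹ volume).2
        exact ENNReal.mul_lt_top hu (ENNReal.mul_lt_top hK hF.2)

theorem integral_integral_mul_smul_eq [CompleteSpace V] (u K : 𝓢(E, ℂ)) {p : ℝ≥0∞}
    (hp : 1 ≤ p) {F : E → V} (hF : MemLp F p) :
    ∫ y, (∫ x, K (y - x) * u x) • F y = ∫ x, u x • ∫ y, K (y - x) • F y := by
  calc ∫ y, (∫ x, K (y - x) * u x) • F y = ∫ y, ∫ x, u x • K (y - x) • F y := by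
        simp only [← integral_smul_const, smul_smul, mul_comm]
    _ = ∫ x, ∫ y, u x • K (y - x) • F y :=
        (integral_integral_swap (integrable_smul_kernel_smul u K hp hF)).symm
    _ = _ := by simp only [integral_smul]

end Kernel

section DistLpNorm

variable {d : ℕ}

/-- The vector fields in `L^p(ℝ^d)`, as equivalence classes. -/
abbrev VectorLp (d : ℕ) (p : ℝ≥0∞) : Type :=
  Lp (EuclideanSpace ℂ (Fin d)) p (volume : Measure (EuclideanSpace ℝ (Fin d)))

theorem distLpNorm_le_eLpNorm {p : ℝ≥0∞} {f : VectorDistribution d}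
    {F : EuclideanSpace ℝ (Fin d) → EuclideanSpace ℂ (Fin d)} (hF : MemLp F p)
    (h : ∀ u : 𝓢(EuclideanSpace ℝ (Fin d), ℂ), f u = ∫ x, u x • F x) :
    distLpNorm p f ≤ eLpNorm F p :=
  iInf_le_of_le F (iInf_le_of_le hF (iInf_le_of_le h le_rfl))

variable {p : ℝ≥0∞} [hp : Fact (1 ≤ p)]

/-- The inclusion of `L^p` into the tempered distributions. -/
noncomputable def distOfLp : VectorLp d p →L[ℂ] VectorDistribution d :=
  Lp.toTemperedDistributionCLM (EuclideanSpace ℂ (Fin d)) volume p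

theorem distOfLp_apply (F : VectorLp d p) (u : 𝓢(EuclideanSpace ℝ (Fin d), ℂ)) :
    distOfLp F u = ∫ x, u x • F x := by
  rw [distOfLp, Lp.toTemperedDistributionCLM_apply, Lp.toTemperedDistribution_apply]

theorem distOfLp_toLp {f : VectorDistribution d}
    {F : EuclideanSpace ℝ (Fin d) → EuclideanSpace ℂ (Fin d)} (hF : MemLp F p)
    (h : ∀ u : 𝓢(EuclideanSpace ℝ (Fin d), ℂ), f u = ∫ x, u x • F x) :
    distOfLp (hF.toLp F) = f := by
  ext1 u
  rw [distOfLp_apply, h]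
  refine integral_congr_ae ?_
  filter_upwards [hF.coeFn_toLp] with x hx
  rw [hx]

theorem exists_distOfLp_eq {f : VectorDistribution d} (hf : distLpNorm p f < ∞) :
    ∃ F : VectorLp d p, distOfLp F = f := by
  simp only [distLpNorm, iInf_lt_iff] at hf
  obtain ⟨F, hF, h, -⟩ := hf
  exact ⟨hF.toLp F, distOfLp_toLp hF h⟩

theorem distOfLp_injective :
    Function.Injective (distOfLp : VectorLp d p →L[ℂ] VectorDistribution d) :=
  LinearMap.ker_eq_bot.1 (Lp.ker_toTemperedDistributionCLM_eq_bot (μ := volume) (p := p))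

theorem distLpNorm_distOfLp (F : VectorLp d p) :
    distLpNorm p (distOfLp F) = ‖F‖ₑ := by
  refine le_antisymm ?_ (le_iInf fun G => le_iInf fun hG => le_iInf fun h => ?_)
  · rw [Lp.enorm_def]
    exact distLpNorm_le_eLpNorm (Lp.memLp F) (distOfLp_apply F)
  · rw [← Lp.enorm_toLp (hf := hG), distOfLp_injective (distOfLp_toLp hG h)]

theorem distLpNorm_zero : distLpNorm p (0 : VectorDistribution d) = 0 := by
  simpa using distLpNorm_distOfLp (0 : VectorLp d p)

theorem distLpNorm_add_le (f g : VectorDistribution d) :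
    distLpNorm p (f + g) ≤ distLpNorm p f + distLpNorm p g := by
  rcases eq_top_or_lt_top (distLpNorm p f) with hf | hf
  · simp [hf]
  rcases eq_top_or_lt_top (distLpNorm p g) with hg | hg
  · simp [hg]
  obtain ⟨F, rfl⟩ := exists_distOfLp_eq hf
  obtain ⟨G, rfl⟩ := exists_distOfLp_eq hg
  rw [← map_add]
  simp only [distLpNorm_distOfLp, enorm_add_le]

theorem distLpNorm_sum_le {ι : Type*} (s : Finset ι) (f : ι → VectorDistribution d) :
    distLpNorm p (∑ i ∈ s, f i) ≤ ∑ i ∈ s, distLpNorm p (f i) :=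
  Finset.le_sum_of_subadditive _ distLpNorm_zero.le distLpNorm_add_le s f

/-- Postcomposition of a distribution with a linear map on its values. -/
noncomputable def mapValues (L : EuclideanSpace ℂ (Fin d) →L[ℂ] EuclideanSpace ℂ (Fin d)) :
    VectorDistribution d →L[ℂ] VectorDistribution d :=
  PointwiseConvergenceCLM.postcomp _ L

theorem distLpNorm_mapValues_le (L : EuclideanSpace ℂ (Fin d) →L[ℂ] EuclideanSpace ℂ (Fin d))
    {f : VectorDistribution d} (hf : distLpNorm p f < ∞) :
    distLpNorm p (mapValues L f) ≤ ‖L‖ₑ * distLpNorm p f := by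
  obtain ⟨F, rfl⟩ := exists_distOfLp_eq hf
  have hL : distOfLp (L.compLp F) = mapValues L (distOfLp F) := by
    ext1 u
    calc (distOfLp (L.compLp F)) u = ∫ x, L (u x • F x) := by
          rw [distOfLp_apply]
          refine integral_congr_ae ?_
          filter_upwards [L.coeFn_compLp F] with x hx
          rw [hx, map_smul]
      _ = L (∫ x, u x • F x) :=
          L.integral_comp_comm (integrable_schwartz_smul u hp.out (Lp.memLp F))
      _ = mapValues L (distOfLp F) u := by
          rw [← distOfLp_apply]; rfl
  rw [← hL, distLpNorm_distOfLp, distLpNorm_distOfLp]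
  rw [enorm_eq_nnnorm, enorm_eq_nnnorm, enorm_eq_nnnorm]
  exact_mod_cast L.norm_compLp_le F

theorem exists_hasSum_distLpNorm_le_tsum {ι : Type*} {f : ι → VectorDistribution d}
    (hf : ∑' i, distLpNorm p (f i) < ∞) :
    ∃ g, HasSum f g ∧ distLpNorm p g ≤ ∑' i, distLpNorm p (f i) := by
  choose F hF using fun i =>
    exists_distOfLp_eq ((ENNReal.le_tsum (f := fun i => distLpNorm p (f i)) i).trans_lt hf)
  obtain rfl : (fun i => distOfLp (F i)) = f := funext hF
  simp only [distLpNorm_distOfLp] at hf ⊢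
  refine ⟨distOfLp (∑' i, F i), ?_, ?_⟩
  · exact (Summable.of_enorm hf.ne).hasSum.mapL distOfLp
  · rw [distLpNorm_distOfLp]
    exact enorm_tsum_le_tsum_enorm

end DistLpNorm

section MultiplierBounds

open TemperedDistribution

variable {d : ℕ} {p : ℝ≥0∞} [hp : Fact (1 ≤ p)]

theorem fourierMultiplierCLM_distOfLp_apply (m : 𝓢(EuclideanSpace ℝ (Fin d), ℂ))
    (F : VectorLp d p) (u : 𝓢(EuclideanSpace ℝ (Fin d), ℂ)) :
    fourierMultiplierCLM (EuclideanSpace ℂ (Fin d)) (⇑m) (distOfLp F) u =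
      ∫ x, u x • ∫ y, 𝓕 m (y - x) • F y := by
  rw [fourierMultiplierCLM_apply_apply, distOfLp_apply,
    ← integral_integral_mul_smul_eq u (𝓕 m) hp.out (Lp.memLp F)]
  simp only [fourier_smulLeftCLM_fourierInv_apply]

theorem distLpNorm_top_fourierMultiplierCLM_le (m : 𝓢(EuclideanSpace ℝ (Fin d), ℂ)) {q : ℝ≥0∞}
    [p.HolderConjugate q] (F : VectorLp d p) :
    distLpNorm ∞ (fourierMultiplierCLM (EuclideanSpace ℂ (Fin d)) (⇑m) (distOfLp F)) ≤
      eLpNorm (𝓕 ⇑m) q * ‖F‖ₑ := by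
  have hbound : eLpNorm (fun x => ∫ y, 𝓕 m (y - x) • F y) ∞ ≤ eLpNorm (𝓕 ⇑m) q * ‖F‖ₑ := by
    rw [eLpNorm_exponent_top, Lp.enorm_def]
    refine eLpNormEssSup_le_of_ae_enorm_bound (.of_forall fun x => ?_)
    exact (enorm_integral_le_lintegral_enorm _).trans
      (lintegral_enorm_mul_sub_le (𝓕 m).continuous.aestronglyMeasurable
        (Lp.aestronglyMeasurable F) x)
  have hK : eLpNorm (𝓕 ⇑m) q < ∞ := ((𝓕 m).memLp q volume).2
  have hmem : MemLp (fun x => ∫ y, 𝓕 m (y - x) • F y) ∞ :=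
    ⟨(aestronglyMeasurable_kernel_smul (𝓕 m).continuous
      (Lp.aestronglyMeasurable F)).integral_prod_right',
      hbound.trans_lt (ENNReal.mul_lt_top hK enorm_lt_top)⟩
  exact (distLpNorm_le_eLpNorm hmem (fourierMultiplierCLM_distOfLp_apply m F)).trans hbound

theorem distOfLp_vadd_apply (z : EuclideanSpace ℝ (Fin d)) (F : VectorLp d p)
    (u : 𝓢(EuclideanSpace ℝ (Fin d), ℂ)) :
    distOfLp (DomAddAct.mk z +ᵥ F) u = ∫ y, u (y - z) • F y := by
  calc distOfLp (DomAddAct.mk z +ᵥ F) u = ∫ y, u y • F (z + y) := by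
        rw [distOfLp_apply]
        refine integral_congr_ae ?_
        filter_upwards [DomAddAct.vadd_Lp_ae_eq (DomAddAct.mk z) F] with y hy
        rw [hy]; rfl
    _ = ∫ y, u (y - z) • F y := by
        simpa using (integral_sub_right_eq_self (fun y => u y • F (z + y)) z).symm

theorem integrable_smul_vadd [Fact (p ≠ ∞)] (K : 𝓢(EuclideanSpace ℝ (Fin d), ℂ))
    (F : VectorLp d p) : Integrable fun z => K z • (DomAddAct.mk z +ᵥ F) := by
  have hcont : Continuous fun z : EuclideanSpace ℝ (Fin d) => DomAddAct.mk z +ᵥ F :=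
    DomAddAct.continuous_mk.vadd continuous_const
  refine (K.integrable.norm.mul_const ‖F‖).mono'
    (K.continuous.smul hcont).aestronglyMeasurable (.of_forall fun z => ?_)
  rw [norm_smul, DomAddAct.norm_vadd_Lp]

theorem fourierMultiplierCLM_distOfLp [Fact (p ≠ ∞)] (m : 𝓢(EuclideanSpace ℝ (Fin d), ℂ))
    (F : VectorLp d p) :
    fourierMultiplierCLM (EuclideanSpace ℂ (Fin d)) (⇑m) (distOfLp F) =
      distOfLp (∫ z, 𝓕 m z • (DomAddAct.mk z +ᵥ F)) := by
  ext1 u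
  calc _ = ∫ y, (∫ z, u (y - z) * 𝓕 m z) • F y := by
        rw [fourierMultiplierCLM_apply_apply, distOfLp_apply]
        refine integral_congr_ae (.of_forall fun y => ?_)
        simp only [fourier_smulLeftCLM_fourierInv_apply]
        rw [← integral_sub_left_eq_self _ _ y]
        simp [mul_comm]
    _ = ∫ z, 𝓕 m z • ∫ y, u (y - z) • F y :=
        integral_integral_mul_smul_eq (𝓕 m) u hp.out (Lp.memLp F)
    _ = ∫ z, distOfLp (𝓕 m z • (DomAddAct.mk z +ᵥ F)) u := by
        simp only [map_smul, ← distOfLp_vadd_apply]; rfl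
    _ = _ := (PointwiseConvergenceCLM.evalCLM _ _ u ∘L distOfLp).integral_comp_comm
        (integrable_smul_vadd (𝓕 m) F)

theorem distLpNorm_fourierMultiplierCLM_le (m : 𝓢(EuclideanSpace ℝ (Fin d), ℂ))
    (F : VectorLp d p) :
    distLpNorm p (fourierMultiplierCLM (EuclideanSpace ℂ (Fin d)) (⇑m) (distOfLp F)) ≤
      eLpNorm (𝓕 ⇑m) 1 * ‖F‖ₑ := by
  rcases eq_or_ne p ∞ with rfl | htop
  · exact distLpNorm_top_fourierMultiplierCLM_le m F
  have : Fact (p ≠ ∞) := ⟨htop⟩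
  rw [fourierMultiplierCLM_distOfLp, distLpNorm_distOfLp, eLpNorm_one_eq_lintegral_enorm,
    ← lintegral_mul_const _ (𝓕 m).continuous.enorm.measurable]
  refine (enorm_integral_le_lintegral_enorm _).trans_eq (lintegral_congr fun z => ?_)
  rw [← ofReal_norm, norm_smul, DomAddAct.norm_vadd_Lp, ENNReal.ofReal_mul (norm_nonneg _),
    ofReal_norm, ofReal_norm]
  rfl

end MultiplierBounds

section Dilation

variable {E V : Type*} [NormedAddCommGroup E] [InnerProductSpace ℝ E] [FiniteDimensional ℝ E]
  [MeasurableSpace E] [BorelSpace E] [NormedAddCommGroup V]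

open Module (finrank)

theorem eLpNorm_comp_smul (f : E → V) {c : ℝ} (hc : 0 < c) (q : ℝ≥0∞) :
    eLpNorm (fun x => f (c • x)) q =
      ENNReal.ofReal c ^ (-(finrank ℝ E * q⁻¹.toReal)) * eLpNorm f q := by
  have hmap : Measure.map (c • ·) (volume : Measure E) =
      (ENNReal.ofReal c ^ (-(finrank ℝ E : ℝ))) • volume := by
    rw [Measure.map_addHaar_smul volume hc.ne', abs_of_pos (by positivity),
      ENNReal.ofReal_rpow_of_pos hc, Real.rpow_neg hc.le, Real.rpow_natCast]
  have hne : ENNReal.ofReal c ^ (-(finrank ℝ E : ℝ)) ≠ 0 := by simp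
  have hemb : MeasurableEmbedding (c • · : E → E) :=
    (Homeomorph.smulOfNeZero c hc.ne').measurableEmbedding
  have h := hemb.eLpNorm_map_measure (g := f) (p := q) (μ := volume)
  rw [hmap, eLpNorm_smul_measure_of_ne_zero hne, ← ENNReal.rpow_mul, one_div, neg_mul] at h
  exact h.symm

variable [NormedSpace ℂ V]

theorem fourier_comp_smul (f : E → V) {c : ℝ} (hc : 0 < c) (x : E) :
    𝓕 (fun ξ => f (c • ξ)) x = (c ^ finrank ℝ E)⁻¹ • 𝓕 f (c⁻¹ • x) := by
  rw [Real.fourier_eq, Real.fourier_eq, ← Measure.integral_comp_smul_of_nonneg volume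
    (fun v => Real.fourierChar (-(inner ℝ v (c⁻¹ • x))) • f v) c (hR := hc.le)]
  simp [inner_smul_left, inner_smul_right, hc.ne']

theorem eLpNorm_fourier_comp_smul (f : E → V) {c : ℝ} (hc : 0 < c) (p : ℝ≥0∞) {q : ℝ≥0∞}
    [hpq : p.HolderConjugate q] :
    eLpNorm (𝓕 fun ξ => f (c • ξ)) q =
      ENNReal.ofReal c ^ (-(finrank ℝ E * p⁻¹.toReal)) * eLpNorm (𝓕 f) q := by
  have hc' : ENNReal.ofReal c⁻¹ = (ENNReal.ofReal c)⁻¹ := ENNReal.ofReal_inv_of_pos hc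
  have hexp : p⁻¹.toReal + q⁻¹.toReal = 1 := by
    rw [← ENNReal.toReal_add (ENNReal.inv_ne_top.2 (ENNReal.HolderConjugate.ne_zero p q))
      (ENNReal.inv_ne_top.2 (ENNReal.HolderConjugate.ne_zero q p)),
      ENNReal.HolderConjugate.inv_add_inv_eq_one p q, ENNReal.toReal_one]
  have hscal : ‖((c ^ finrank ℝ E)⁻¹ : ℝ)‖ₑ = ENNReal.ofReal c ^ (-(finrank ℝ E : ℝ)) := by
    rw [Real.enorm_of_nonneg (by positivity), ENNReal.ofReal_rpow_of_pos hc, Real.rpow_neg hc.le,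
      Real.rpow_natCast]
  have hfun : (𝓕 fun ξ => f (c • ξ)) =
      ((c ^ finrank ℝ E)⁻¹ : ℝ) • fun x => 𝓕 f (c⁻¹ • x) := funext (fourier_comp_smul f hc)
  rw [hfun, eLpNorm_const_smul, eLpNorm_comp_smul _ (inv_pos.2 hc), hscal, hc',
    ENNReal.inv_rpow, ← ENNReal.rpow_neg, neg_neg, ← mul_assoc,
    ← ENNReal.rpow_add _ _ (by simpa using hc) ENNReal.ofReal_ne_top]
  congr 2
  linear_combination (finrank ℝ E : ℝ) * hexp

end Dilation

section Symbols

variable {d : ℕ}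

/-- A smooth symbol supported in an annulus. The annulus `3/8 ≤ |ξ| ≤ 16/3` leaves room for the
neighbouring dilates of a Littlewood–Paley function. -/
structure IsAnnularSymbol (m : EuclideanSpace ℝ (Fin d) → ℂ) : Prop where
  smooth : ContDiff ℝ (⊤ : ℕ∞) m
  support : ∀ ξ, m ξ ≠ 0 → 3 / 8 ≤ ‖ξ‖ ∧ ‖ξ‖ ≤ 16 / 3

/-- The symbol of `m(2⁻ʲ D)`, with the `2π` of Mathlib's Fourier transform as in `lpProj`. -/
noncomputable def dyadicSymbol (m : EuclideanSpace ℝ (Fin d) → ℂ) (j : ℤ)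
    (ξ : EuclideanSpace ℝ (Fin d)) : ℂ :=
  m ((2 : ℝ) ^ (-j) • (2 * Real.pi) • ξ)

/-- The Fourier multiplier `m(2⁻ʲ D)`. -/
noncomputable def dyadicMul (m : EuclideanSpace ℝ (Fin d) → ℂ) (j : ℤ) :
    VectorDistribution d →L[ℂ] VectorDistribution d :=
  TemperedDistribution.fourierMultiplierCLM (EuclideanSpace ℂ (Fin d)) (dyadicSymbol m j)

theorem dyadicScale_pos (j : ℤ) : 0 < (2 : ℝ) ^ (-j) * (2 * Real.pi) := by
  positivity

theorem dyadicSymbol_eq (m : EuclideanSpace ℝ (Fin d) → ℂ) (j : ℤ) :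
    dyadicSymbol m j = fun ξ => m (((2 : ℝ) ^ (-j) * (2 * Real.pi)) • ξ) := by
  ext ξ
  rw [dyadicSymbol, smul_smul]

theorem lpProj_eq_dyadicMul (φ : EuclideanSpace ℝ (Fin d) → ℝ) (j : ℤ)
    (f : VectorDistribution d) : lpProj φ j f = dyadicMul (fun ξ => (φ ξ : ℂ)) j f := rfl

theorem dyadicMul_mapValues (m : EuclideanSpace ℝ (Fin d) → ℂ) (j : ℤ)
    (L : EuclideanSpace ℂ (Fin d) →L[ℂ] EuclideanSpace ℂ (Fin d)) (f : VectorDistribution d) :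
    dyadicMul m j (mapValues L f) = mapValues L (dyadicMul m j f) := rfl

namespace IsAnnularSymbol

variable {m n : EuclideanSpace ℝ (Fin d) → ℂ}

theorem hasCompactSupport (hm : IsAnnularSymbol m) : HasCompactSupport m := by
  refine HasCompactSupport.intro (isCompact_closedBall (0 : EuclideanSpace ℝ (Fin d)) (16 / 3))
    fun ξ hξ => ?_
  by_contra h
  exact hξ (by simpa using (hm.support ξ h).2)

theorem mul_of_contDiffAt (hm : IsAnnularSymbol m) {h : EuclideanSpace ℝ (Fin d) → ℂ}
    (hh : ∀ ξ, ξ ≠ 0 → ContDiffAt ℝ (⊤ : ℕ∞) h ξ) : IsAnnularSymbol fun ξ => h ξ * m ξ := by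
  refine ⟨contDiff_iff_contDiffAt.2 fun ξ => ?_,
    fun ξ hξ => hm.support ξ (right_ne_zero_of_mul hξ)⟩
  rcases eq_or_ne ξ 0 with rfl | h0
  · refine contDiffAt_const (c := 0) |>.congr_of_eventuallyEq ?_
    filter_upwards [Metric.ball_mem_nhds 0 (by norm_num : (0 : ℝ) < 3 / 8)] with η hη
    rw [mul_eq_zero, or_iff_not_imp_right]
    intro h1
    linarith [(hm.support η h1).1, mem_ball_zero_iff.1 hη]
  · exact (hh ξ h0).mul hm.smooth.contDiffAt

theorem contDiff_dyadicSymbol (hm : IsAnnularSymbol m) (j : ℤ) :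
    ContDiff ℝ (⊤ : ℕ∞) (dyadicSymbol m j) := by
  rw [dyadicSymbol_eq]
  exact hm.smooth.comp (contDiff_const_smul _)

theorem hasCompactSupport_dyadicSymbol (hm : IsAnnularSymbol m) (j : ℤ) :
    HasCompactSupport (dyadicSymbol m j) := by
  rw [dyadicSymbol_eq]
  exact hm.hasCompactSupport.comp_smul (dyadicScale_pos j).ne'

theorem hasTemperateGrowth_dyadicSymbol (hm : IsAnnularSymbol m) (j : ℤ) :
    (dyadicSymbol m j).HasTemperateGrowth :=
  (hm.hasCompactSupport_dyadicSymbol j).hasTemperateGrowth (hm.contDiff_dyadicSymbol j)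

theorem dyadicMul_dyadicMul (hm : IsAnnularSymbol m) (hn : IsAnnularSymbol n) (j k : ℤ)
    (f : VectorDistribution d) :
    dyadicMul m j (dyadicMul n k f) = TemperedDistribution.fourierMultiplierCLM
      (EuclideanSpace ℂ (Fin d)) (dyadicSymbol n k * dyadicSymbol m j) f :=
  TemperedDistribution.fourierMultiplierCLM_fourierMultiplierCLM_apply
    (hn.hasTemperateGrowth_dyadicSymbol k) (hm.hasTemperateGrowth_dyadicSymbol j) f

theorem exists_eLpNorm_fourier_dyadicSymbol (hm : IsAnnularSymbol m) (p q : ℝ≥0∞)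
    [p.HolderConjugate q] : ∃ C : ℝ≥0, ∀ j : ℤ,
      eLpNorm (𝓕 (dyadicSymbol m j)) q = C * 2 ^ (j * (d * p⁻¹.toReal)) := by
  have hfin : eLpNorm (𝓕 m) q < ∞ :=
    ((𝓕 (hm.hasCompactSupport.toSchwartzMap hm.smooth)).memLp q volume).2
  have hπ0 : ENNReal.ofReal (2 * Real.pi) ≠ 0 := by simp [Real.pi_pos]
  lift eLpNorm (𝓕 m) q to ℝ≥0 using hfin.ne with K hK
  lift ENNReal.ofReal (2 * Real.pi) ^ (-(d * p⁻¹.toReal)) to ℝ≥0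
    using ENNReal.rpow_ne_top_of_ne_zero hπ0 ENNReal.ofReal_ne_top with L hL
  refine ⟨L * K, fun j => ?_⟩
  have h2 : ENNReal.ofReal ((2 : ℝ) ^ (-j)) = 2 ^ (-j : ℝ) := by
    rw [← Real.rpow_intCast, ← ENNReal.ofReal_rpow_of_pos two_pos, ENNReal.ofReal_ofNat,
      Int.cast_neg]
  rw [dyadicSymbol_eq, eLpNorm_fourier_comp_smul m (dyadicScale_pos j) p, ← hK,
    finrank_euclideanSpace_fin, ENNReal.ofReal_mul (by positivity), h2,
    ENNReal.mul_rpow_of_ne_zero (by simp) hπ0, ← hL, ← ENNReal.rpow_mul, neg_mul_neg,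
    ENNReal.coe_mul]
  ring

theorem exists_distLpNorm_dyadicMul_le (hm : IsAnnularSymbol m) :
    ∃ C : ℝ≥0, ∀ (j : ℤ) (p : ℝ≥0∞) [Fact (1 ≤ p)] (f : VectorDistribution d),
      distLpNorm p (dyadicMul m j f) ≤ C * distLpNorm p f := by
  obtain ⟨C, hC⟩ := hm.exists_eLpNorm_fourier_dyadicSymbol ∞ 1
  refine ⟨C + 1, fun j p _ f => ?_⟩
  rcases eq_top_or_lt_top (distLpNorm p f) with hf | hf
  · simp [hf]
  obtain ⟨F, rfl⟩ := exists_distOfLp_eq hf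
  refine (distLpNorm_fourierMultiplierCLM_le ((hm.hasCompactSupport_dyadicSymbol j).toSchwartzMap
    (hm.contDiff_dyadicSymbol j)) F).trans ?_
  rw [distLpNorm_distOfLp]
  gcongr
  refine (hC j).trans_le ?_
  simp

theorem exists_distLpNorm_top_dyadicMul_le (hm : IsAnnularSymbol m) (p : ℝ≥0∞)
    [hp : Fact (1 ≤ p)] : ∃ C : ℝ≥0, ∀ (j : ℤ) (f : VectorDistribution d), distLpNorm p f < ∞ →
      distLpNorm ∞ (dyadicMul m j f) ≤ C * 2 ^ (j * (d * p⁻¹.toReal)) * distLpNorm p f := by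
  have := ENNReal.HolderConjugate.inv_one_sub_inv' hp.out
  obtain ⟨C, hC⟩ := hm.exists_eLpNorm_fourier_dyadicSymbol p (1 - p⁻¹)⁻¹
  refine ⟨C, fun j f hf => ?_⟩
  obtain ⟨F, rfl⟩ := exists_distOfLp_eq hf
  refine (distLpNorm_top_fourierMultiplierCLM_le (q := (1 - p⁻¹)⁻¹)
    ((hm.hasCompactSupport_dyadicSymbol j).toSchwartzMap (hm.contDiff_dyadicSymbol j)) F).trans ?_
  rw [distLpNorm_distOfLp]
  gcongr
  exact (hC j).le

end IsAnnularSymbol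

end Symbols

section LittlewoodPaley

variable {d : ℕ} {φ : EuclideanSpace ℝ (Fin d) → ℝ}

/-- The distribution `f` is the sum of its five Littlewood–Paley blocks around frequency `2^j`. -/
structure IsDyadicBlock (φ : EuclideanSpace ℝ (Fin d) → ℝ) (j : ℤ) (f : VectorDistribution d) :
    Prop where
  lpProj_eq_zero : ∀ i ∉ Finset.Icc (-2 : ℤ) 2, lpProj φ (j + i) f = 0
  sum_lpProj : ∑ i ∈ Finset.Icc (-2 : ℤ) 2, lpProj φ (j + i) f = f

namespace IsDyadicBlock

theorem mapValues (L : EuclideanSpace ℂ (Fin d) →L[ℂ] EuclideanSpace ℂ (Fin d)) {j : ℤ}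
    {f : VectorDistribution d} (hf : IsDyadicBlock φ j f) :
    IsDyadicBlock φ j (mapValues L f) where
  lpProj_eq_zero i hi := by
    rw [lpProj_eq_dyadicMul, dyadicMul_mapValues, ← lpProj_eq_dyadicMul, hf.lpProj_eq_zero i hi,
      map_zero]
  sum_lpProj := by
    simp only [lpProj_eq_dyadicMul, dyadicMul_mapValues, ← map_sum]
    simp only [← lpProj_eq_dyadicMul, hf.sum_lpProj]

theorem sum {ι : Type*} {s : Finset ι} {j : ℤ} {f : ι → VectorDistribution d}
    (hf : ∀ a ∈ s, IsDyadicBlock φ j (f a)) : IsDyadicBlock φ j (∑ a ∈ s, f a) where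
  lpProj_eq_zero i hi := by
    rw [lpProj_eq_dyadicMul, map_sum]
    exact Finset.sum_eq_zero fun a ha => (hf a ha).lpProj_eq_zero i hi
  sum_lpProj := by
    simp only [lpProj_eq_dyadicMul, map_sum]
    rw [Finset.sum_comm]
    exact Finset.sum_congr rfl fun a ha => (hf a ha).sum_lpProj

end IsDyadicBlock

theorem dyadicSymbol_add (m : EuclideanSpace ℝ (Fin d) → ℂ) (j i : ℤ)
    (ξ : EuclideanSpace ℝ (Fin d)) :
    dyadicSymbol m (j + i) ξ = m ((2 : ℝ) ^ (-i) • (2 : ℝ) ^ (-j) • (2 * Real.pi) • ξ) := by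
  rw [dyadicSymbol, smul_smul ((2 : ℝ) ^ (-i)), ← zpow_add₀ two_ne_zero, neg_add_rev]

/-- The sum of three consecutive dilates of `φ`, which equals one on the support of `φ`. -/
noncomputable def fatten (φ : EuclideanSpace ℝ (Fin d) → ℝ) (ξ : EuclideanSpace ℝ (Fin d)) : ℝ :=
  ∑ i ∈ Finset.Icc (-1 : ℤ) 1, φ ((2 : ℝ) ^ (-i) • ξ)

namespace IsLittlewoodPaley

variable (hφ : IsLittlewoodPaley φ)
include hφ

theorem isAnnularSymbol : IsAnnularSymbol fun ξ => (φ ξ : ℂ) := by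
  refine ⟨Complex.ofRealCLM.contDiff.comp hφ.smooth, fun ξ hξ => ?_⟩
  have := hφ.support ξ (by exact_mod_cast hξ)
  constructor <;> linarith [this.1, this.2]

theorem norm_le_of_apply_zpow_smul_ne_zero {i : ℤ} {ξ : EuclideanSpace ℝ (Fin d)}
    (h : φ ((2 : ℝ) ^ (-i) • ξ) ≠ 0) :
    3 / 4 * (2 : ℝ) ^ i ≤ ‖ξ‖ ∧ ‖ξ‖ ≤ 8 / 3 * (2 : ℝ) ^ i := by
  have h3 := hφ.support _ h
  rwa [norm_smul, norm_zpow, Real.norm_ofNat, zpow_neg, inv_mul_eq_div, le_div_iff₀ (by positivity),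
    div_le_iff₀ (by positivity)] at h3

theorem apply_zpow_smul_eq_zero {i : ℤ} {ξ : EuclideanSpace ℝ (Fin d)} {k : ℤ}
    (h1 : 8 / 3 * (2 : ℝ) ^ (-k - 1) < ‖ξ‖) (h2 : ‖ξ‖ < 3 / 4 * (2 : ℝ) ^ (k + 1))
    (hi : i ∉ Finset.Icc (-k) k) : φ ((2 : ℝ) ^ (-i) • ξ) = 0 := by
  by_contra h
  obtain ⟨h3, h4⟩ := hφ.norm_le_of_apply_zpow_smul_ne_zero h
  have h5 : -k - 1 < i := (zpow_lt_zpow_iff_right₀ (one_lt_two (α := ℝ))).1 (by linarith)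
  have h6 : i < k + 1 := (zpow_lt_zpow_iff_right₀ (one_lt_two (α := ℝ))).1 (by linarith)
  exact hi (Finset.mem_Icc.2 ⟨by omega, by omega⟩)

theorem sum_apply_zpow_smul {ξ : EuclideanSpace ℝ (Fin d)} {k : ℤ}
    (h1 : 8 / 3 * (2 : ℝ) ^ (-k - 1) < ‖ξ‖) (h2 : ‖ξ‖ < 3 / 4 * (2 : ℝ) ^ (k + 1)) :
    ∑ i ∈ Finset.Icc (-k) k, φ ((2 : ℝ) ^ (-i) • ξ) = 1 := by
  have h0 : 0 < ‖ξ‖ := h1.trans_le' (by positivity)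
  exact (hasSum_sum_of_ne_finset_zero fun i hi => hφ.apply_zpow_smul_eq_zero h1 h2 hi).unique
    (hφ.partition ξ (norm_pos_iff.1 h0))

theorem isDyadicBlock_dyadicMul {m : EuclideanSpace ℝ (Fin d) → ℂ} (hm : IsAnnularSymbol m)
    (j : ℤ) (f : VectorDistribution d) : IsDyadicBlock φ j (dyadicMul m j f) where
  lpProj_eq_zero i hi := by
    have : dyadicSymbol m j * dyadicSymbol (fun ξ => (φ ξ : ℂ)) (j + i) = fun _ => 0 := by
      ext ξ
      rw [Pi.mul_apply, dyadicSymbol_add, dyadicSymbol, mul_eq_zero, or_iff_not_imp_left]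
      intro h0
      have hsupp := hm.support _ h0
      rw [hφ.apply_zpow_smul_eq_zero (k := 2) _ _ hi, Complex.ofReal_zero] <;>
        norm_num at hsupp ⊢ <;> linarith [hsupp.1, hsupp.2]
    rw [lpProj_eq_dyadicMul, hφ.isAnnularSymbol.dyadicMul_dyadicMul hm, this,
      TemperedDistribution.fourierMultiplierCLM_const, zero_smul]
    rfl
  sum_lpProj := by
    have hsymb : (fun ξ => ∑ i ∈ Finset.Icc (-2 : ℤ) 2,
        (dyadicSymbol m j * dyadicSymbol (fun ξ => (φ ξ : ℂ)) (j + i)) ξ) = dyadicSymbol m j := by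
      ext ξ
      simp only [Pi.mul_apply, dyadicSymbol_add, ← Finset.mul_sum, ← Complex.ofReal_sum]
      rcases eq_or_ne (dyadicSymbol m j ξ) 0 with h0 | h0
      · rw [h0, zero_mul]
      have hsupp := hm.support _ h0
      rw [hφ.sum_apply_zpow_smul (k := 2), Complex.ofReal_one, mul_one] <;>
        norm_num at hsupp ⊢ <;> linarith [hsupp.1, hsupp.2]
    have h := TemperedDistribution.fourierMultiplierCLM_sum (EuclideanSpace ℂ (Fin d))
      (s := Finset.Icc (-2 : ℤ) 2) (fun i _ => (hm.hasTemperateGrowth_dyadicSymbol j).mul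
        (hφ.isAnnularSymbol.hasTemperateGrowth_dyadicSymbol (j + i)))
    simp only [lpProj_eq_dyadicMul, hφ.isAnnularSymbol.dyadicMul_dyadicMul hm,
      ← _root_.sum_apply]
    rw [← h, hsymb, dyadicMul]

theorem isAnnularSymbol_fatten : IsAnnularSymbol fun ξ => (fatten φ ξ : ℂ) := by
  have hs : ContDiff ℝ (⊤ : ℕ∞) (fatten φ) :=
    ContDiff.sum fun (i : ℤ) _ => hφ.smooth.comp (contDiff_const_smul ((2 : ℝ) ^ (-i)))
  refine ⟨Complex.ofRealCLM.contDiff.comp hs, fun ξ hξ => ?_⟩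
  obtain ⟨i, hi, hi'⟩ := Finset.exists_ne_zero_of_sum_ne_zero (Complex.ofReal_ne_zero.1 hξ)
  obtain ⟨h1, h2⟩ := hφ.norm_le_of_apply_zpow_smul_ne_zero hi'
  rw [Finset.mem_Icc] at hi
  have h3 : (2 : ℝ) ^ (-1 : ℤ) ≤ 2 ^ i := zpow_le_zpow_right₀ one_le_two hi.1
  have h4 : (2 : ℝ) ^ i ≤ 2 ^ (1 : ℤ) := zpow_le_zpow_right₀ one_le_two hi.2
  norm_num at h3 h4
  constructor <;> linarith

theorem fatten_mul_self (ξ : EuclideanSpace ℝ (Fin d)) : fatten φ ξ * φ ξ = φ ξ := by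
  rcases eq_or_ne (φ ξ) 0 with h0 | h0
  · rw [h0, mul_zero]
  have hsupp := hφ.support ξ h0
  rw [fatten, hφ.sum_apply_zpow_smul (k := 1), one_mul] <;>
    norm_num <;> linarith [hsupp.1, hsupp.2]

theorem dyadicMul_mul_fatten_lpProj {m : EuclideanSpace ℝ (Fin d) → ℂ}
    (hm : IsAnnularSymbol fun ξ => m ξ * fatten φ ξ) (j : ℤ) (f : VectorDistribution d) :
    dyadicMul (fun ξ => m ξ * fatten φ ξ) j (lpProj φ j f) =
      dyadicMul (fun ξ => m ξ * φ ξ) j f := by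
  rw [lpProj_eq_dyadicMul, hm.dyadicMul_dyadicMul hφ.isAnnularSymbol, dyadicMul]
  congr 2
  ext ξ
  simp only [Pi.mul_apply, dyadicSymbol]
  rw [mul_left_comm, ← Complex.ofReal_mul, mul_comm (φ _), hφ.fatten_mul_self]

end IsLittlewoodPaley

end LittlewoodPaley

section Leray

open TemperedDistribution

variable {d : ℕ} {φ : EuclideanSpace ℝ (Fin d) → ℝ}

/-- The matrix unit sending the coordinate `b` to the coordinate `a`. -/
noncomputable def matrixUnit (a b : Fin d) :
    EuclideanSpace ℂ (Fin d) →L[ℂ] EuclideanSpace ℂ (Fin d) :=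
  (EuclideanSpace.proj b : EuclideanSpace ℂ (Fin d) →L[ℂ] ℂ).smulRight (EuclideanSpace.single a 1)

/-- The matrix entries `δ_ab - ξ_a ξ_b / |ξ|²` of the symbol of the Leray projector. -/
noncomputable def lerayEntry (a b : Fin d) (ξ : EuclideanSpace ℝ (Fin d)) : ℝ :=
  (if a = b then 1 else 0) - ξ a * ξ b / ‖ξ‖ ^ 2

/-- The Leray projector localized at frequency `2^j`. -/
noncomputable def lerayProj (φ : EuclideanSpace ℝ (Fin d) → ℝ) (j : ℤ) :
    VectorDistribution d →L[ℂ] VectorDistribution d :=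
  ∑ ab : Fin d × Fin d, mapValues (matrixUnit ab.1 ab.2) ∘L
    dyadicMul (fun ξ => lerayEntry ab.1 ab.2 ξ * fatten φ ξ) j

theorem lerayProj_apply (j : ℤ) (f : VectorDistribution d) :
    lerayProj φ j f = ∑ ab : Fin d × Fin d, mapValues (matrixUnit ab.1 ab.2)
      (dyadicMul (fun ξ => lerayEntry ab.1 ab.2 ξ * fatten φ ξ) j f) := by
  simp [lerayProj]

theorem lerayProj_apply_apply (j : ℤ) (f : VectorDistribution d)
    (u : 𝓢(EuclideanSpace ℝ (Fin d), ℂ)) (a : Fin d) :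
    lerayProj φ j f u a =
      ∑ b, dyadicMul (fun ξ => lerayEntry a b ξ * fatten φ ξ) j f u b := by
  have h (a b : Fin d) (f : VectorDistribution d) (i : Fin d) :
      mapValues (matrixUnit a b) f u i = if i = a then f u b else 0 := by
    change matrixUnit a b (f u) i = _
    simp [matrixUnit]
  simp [lerayProj_apply, h, Fintype.sum_prod_type]

theorem contDiffAt_lerayEntry (a b : Fin d) {ξ : EuclideanSpace ℝ (Fin d)} (hξ : ξ ≠ 0) :
    ContDiffAt ℝ (⊤ : ℕ∞) (lerayEntry a b) ξ := by
  have hn : ‖ξ‖ ^ 2 ≠ 0 := by simpa using hξ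
  exact contDiffAt_const.sub (ContDiffAt.div (by fun_prop) (contDiff_norm_sq ℝ).contDiffAt hn)

theorem lerayEntry_smul (a b : Fin d) {c : ℝ} (hc : c ≠ 0) (ξ : EuclideanSpace ℝ (Fin d)) :
    lerayEntry a b (c • ξ) = lerayEntry a b ξ := by
  simp only [lerayEntry, PiLp.smul_apply, smul_eq_mul, norm_smul, mul_pow, Real.norm_eq_abs, sq_abs]
  rw [mul_mul_mul_comm, ← sq, mul_div_mul_left _ _ (pow_ne_zero 2 hc)]

theorem sum_mul_lerayEntry (b : Fin d) (ξ : EuclideanSpace ℝ (Fin d)) :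
    ∑ a, ξ a * lerayEntry a b ξ = 0 := by
  rcases eq_or_ne ξ 0 with rfl | hξ
  · simp
  have hn : ‖ξ‖ ^ 2 ≠ 0 := by simpa using hξ
  have hsq : ∑ a, ξ a * (ξ a * ξ b / ‖ξ‖ ^ 2) = ξ b := by
    simp only [← mul_assoc, mul_div_assoc, ← sq]
    rw [← Finset.sum_mul, ← EuclideanSpace.real_norm_sq_eq, mul_div_cancel₀ _ hn]
  simp [lerayEntry, mul_sub, hsq]

theorem dyadicSymbol_lerayEntry_mul (a b : Fin d) (ψ : EuclideanSpace ℝ (Fin d) → ℝ) (j : ℤ)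
    (ξ : EuclideanSpace ℝ (Fin d)) :
    dyadicSymbol (fun ξ => lerayEntry a b ξ * ψ ξ) j ξ =
      lerayEntry a b ξ * dyadicSymbol (fun ξ => (ψ ξ : ℂ)) j ξ := by
  simp only [dyadicSymbol_eq, lerayEntry_smul a b (dyadicScale_pos j).ne']

theorem IsAnnularSymbol.lerayEntry_mul {m : EuclideanSpace ℝ (Fin d) → ℂ} (hm : IsAnnularSymbol m)
    (a b : Fin d) : IsAnnularSymbol fun ξ => lerayEntry a b ξ * m ξ :=
  hm.mul_of_contDiffAt fun ξ hξ =>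
    Complex.ofRealCLM.contDiff.contDiffAt.comp ξ (contDiffAt_lerayEntry a b hξ)

theorem hasTemperateGrowth_coord (i : Fin d) :
    (fun ξ : EuclideanSpace ℝ (Fin d) => (ξ i : ℂ)).HasTemperateGrowth :=
  (Complex.ofRealCLM ∘L (EuclideanSpace.proj i : _ →L[ℝ] ℝ)).hasTemperateGrowth

theorem isDivFree_iff {f : VectorDistribution d} :
    IsDivFree f ↔ ∀ u : 𝓢(EuclideanSpace ℝ (Fin d), ℂ),
      ∑ i, fourierMultiplierCLM (EuclideanSpace ℂ (Fin d)) (fun ξ => (ξ i : ℂ)) f u i = 0 := by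
  have h (i : Fin d) : ∂_{EuclideanSpace.single i (1 : ℝ)} f = (2 * Real.pi * Complex.I) •
      fourierMultiplierCLM (EuclideanSpace ℂ (Fin d)) (fun ξ => (ξ i : ℂ)) f := by
    simp [lineDeriv_eq_fourierMultiplierCLM, EuclideanSpace.inner_single_right]
  simp only [IsDivFree, h]
  refine forall_congr' fun u => ?_
  simp [← Finset.mul_sum, Real.pi_ne_zero]

theorem IsDivFree.sum_fourierMultiplierCLM_mul {f : VectorDistribution d} (hf : IsDivFree f)
    {m : EuclideanSpace ℝ (Fin d) → ℂ} (hm : m.HasTemperateGrowth)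
    (u : 𝓢(EuclideanSpace ℝ (Fin d), ℂ)) :
    ∑ i, fourierMultiplierCLM (EuclideanSpace ℂ (Fin d)) (fun ξ => ξ i * m ξ) f u i = 0 := by
  rw [← isDivFree_iff.1 hf (𝓕 (SchwartzMap.smulLeftCLM ℂ m (𝓕⁻ u)))]
  refine Finset.sum_congr rfl fun i _ => ?_
  rw [← fourierMultiplierCLM_apply_apply m, fourierMultiplierCLM_fourierMultiplierCLM_apply
    (hasTemperateGrowth_coord i) hm]
  rfl

theorem fourierMultiplierCLM_add_apply {m n : EuclideanSpace ℝ (Fin d) → ℂ}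
    (hm : m.HasTemperateGrowth) (hn : n.HasTemperateGrowth) (f : VectorDistribution d) :
    fourierMultiplierCLM (EuclideanSpace ℂ (Fin d)) (m + n) f =
      fourierMultiplierCLM (EuclideanSpace ℂ (Fin d)) m f +
        fourierMultiplierCLM (EuclideanSpace ℂ (Fin d)) n f := by
  simp [fourierMultiplierCLM_apply, smulLeftCLM_add hm hn]

namespace IsLittlewoodPaley

variable (hφ : IsLittlewoodPaley φ)
include hφ

theorem isDyadicBlock_lerayProj (j : ℤ) (f : VectorDistribution d) :
    IsDyadicBlock φ j (lerayProj φ j f) := by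
  rw [lerayProj_apply]
  exact .sum fun ab _ => (hφ.isDyadicBlock_dyadicMul
    (hφ.isAnnularSymbol_fatten.lerayEntry_mul ab.1 ab.2) j f).mapValues _

theorem exists_distLpNorm_lerayProj_le : ∃ C : ℝ≥0, ∀ (j : ℤ) (p : ℝ≥0∞) [Fact (1 ≤ p)]
    (f : VectorDistribution d), distLpNorm p f < ∞ →
      distLpNorm p (lerayProj φ j f) ≤ C * distLpNorm p f := by
  choose C hC using fun ab : Fin d × Fin d =>
    (hφ.isAnnularSymbol_fatten.lerayEntry_mul ab.1 ab.2).exists_distLpNorm_dyadicMul_le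
  refine ⟨∑ ab, ‖matrixUnit ab.1 ab.2‖₊ * C ab, fun j p _ f hf => ?_⟩
  rw [lerayProj_apply, ENNReal.ofNNReal_finsetSum, Finset.sum_mul]
  refine (distLpNorm_sum_le _ _).trans (Finset.sum_le_sum fun ab _ => ?_)
  have hab := hC ab j p f
  refine (distLpNorm_mapValues_le _
    (hab.trans_lt (ENNReal.mul_lt_top ENNReal.coe_lt_top hf))).trans ?_
  rw [ENNReal.coe_mul, mul_assoc]
  gcongr
  rfl

theorem fourierMultiplierCLM_lerayProj_apply_apply {m : EuclideanSpace ℝ (Fin d) → ℂ}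
    (hm : m.HasTemperateGrowth) (j : ℤ) (f : VectorDistribution d)
    (u : 𝓢(EuclideanSpace ℝ (Fin d), ℂ)) (a : Fin d) :
    fourierMultiplierCLM (EuclideanSpace ℂ (Fin d)) m (lerayProj φ j f) u a =
      ∑ b, fourierMultiplierCLM (EuclideanSpace ℂ (Fin d))
        (dyadicSymbol (fun ξ => lerayEntry a b ξ * fatten φ ξ) j * m) f u b := by
  rw [fourierMultiplierCLM_apply_apply, lerayProj_apply_apply]
  refine Finset.sum_congr rfl fun b _ => ?_
  rw [← fourierMultiplierCLM_fourierMultiplierCLM_apply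
    ((hφ.isAnnularSymbol_fatten.lerayEntry_mul a b).hasTemperateGrowth_dyadicSymbol j) hm]
  rfl

theorem isDivFree_lerayProj (j : ℤ) (f : VectorDistribution d) :
    IsDivFree (lerayProj φ j f) := by
  refine isDivFree_iff.2 fun u => ?_
  simp only [fun a => hφ.fourierMultiplierCLM_lerayProj_apply_apply (hasTemperateGrowth_coord a)]
  rw [Finset.sum_comm]
  refine Finset.sum_eq_zero fun b _ => ?_
  set σ : Fin d → EuclideanSpace ℝ (Fin d) → ℂ := fun a =>
    dyadicSymbol (fun ξ => lerayEntry a b ξ * fatten φ ξ) j * fun ξ => (ξ a : ℂ)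
  have hσ (a : Fin d) : (σ a).HasTemperateGrowth :=
    ((hφ.isAnnularSymbol_fatten.lerayEntry_mul a b).hasTemperateGrowth_dyadicSymbol j).mul
      (hasTemperateGrowth_coord a)
  have hsum : (∑ a, σ a ·) = fun _ => 0 := by
    ext ξ
    have hξ : ∑ a, (ξ a : ℂ) * lerayEntry a b ξ = 0 := by
      exact_mod_cast sum_mul_lerayEntry b ξ
    calc ∑ a, σ a ξ = (∑ a, (ξ a : ℂ) * lerayEntry a b ξ) *
          dyadicSymbol (fun ξ => (fatten φ ξ : ℂ)) j ξ := by
          rw [Finset.sum_mul]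
          refine Finset.sum_congr rfl fun a _ => ?_
          change dyadicSymbol _ j ξ * (ξ a : ℂ) = _
          rw [dyadicSymbol_lerayEntry_mul, mul_comm, mul_assoc]
      _ = 0 := by rw [hξ, zero_mul]
  have h := congrArg (fun T => T f u b)
    (fourierMultiplierCLM_sum (EuclideanSpace ℂ (Fin d)) (s := .univ) fun a _ => hσ a)
  simpa [hsum] using h.symm

theorem hasTemperateGrowth_coord_div_normSq_mul (a : Fin d) (j : ℤ) :
    (fun ξ : EuclideanSpace ℝ (Fin d) => (ξ a / ‖ξ‖ ^ 2 : ℝ) *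
      dyadicSymbol (fun ξ => (φ ξ : ℂ)) j ξ).HasTemperateGrowth := by
  have hm : IsAnnularSymbol fun ξ => (ξ a / ‖ξ‖ ^ 2 : ℝ) * (φ ξ : ℂ) :=
    hφ.isAnnularSymbol.mul_of_contDiffAt fun ξ hξ =>
      Complex.ofRealCLM.contDiff.contDiffAt.comp ξ (ContDiffAt.div (by fun_prop)
        (contDiff_norm_sq ℝ).contDiffAt (by simpa using hξ))
  set c : ℝ := (2 : ℝ) ^ (-j) * (2 * Real.pi)
  have hc : c ≠ 0 := (dyadicScale_pos j).ne'
  have hsymb : (fun ξ : EuclideanSpace ℝ (Fin d) => (ξ a / ‖ξ‖ ^ 2 : ℝ) *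
      dyadicSymbol (fun ξ => (φ ξ : ℂ)) j ξ) =
      (fun _ => (c : ℂ)) * dyadicSymbol (fun ξ => (ξ a / ‖ξ‖ ^ 2 : ℝ) * (φ ξ : ℂ)) j := by
    ext ξ
    have hξ : ξ a / ‖ξ‖ ^ 2 = c * ((c • ξ) a / ‖c • ξ‖ ^ 2) := by
      rw [PiLp.smul_apply, smul_eq_mul, norm_smul, mul_pow, Real.norm_eq_abs, sq_abs]
      field_simp
    simp only [dyadicSymbol_eq, hξ, Complex.ofReal_mul, Pi.mul_apply, mul_assoc, c]
  rw [hsymb]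
  exact (Function.HasTemperateGrowth.const (c : ℂ)).mul (hm.hasTemperateGrowth_dyadicSymbol j)

theorem lerayProj_lpProj {g : VectorDistribution d} (hg : IsDivFree g) (j : ℤ) :
    lerayProj φ j (lpProj φ j g) = lpProj φ j g := by
  set Φ := dyadicSymbol (fun ξ => (φ ξ : ℂ)) j
  ext u a
  have hentry (b : Fin d) : dyadicMul (fun ξ => lerayEntry a b ξ * fatten φ ξ) j (lpProj φ j g) +
      fourierMultiplierCLM (EuclideanSpace ℂ (Fin d))
        (fun ξ => ξ b * ((ξ a / ‖ξ‖ ^ 2 : ℝ) * Φ ξ)) g = if a = b then lpProj φ j g else 0 := by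
    have hn : (fun ξ => ξ b * ((ξ a / ‖ξ‖ ^ 2 : ℝ) * Φ ξ)).HasTemperateGrowth :=
      (hasTemperateGrowth_coord b).mul (hφ.hasTemperateGrowth_coord_div_normSq_mul a j)
    rw [hφ.dyadicMul_mul_fatten_lpProj (hφ.isAnnularSymbol_fatten.lerayEntry_mul a b), dyadicMul,
      ← fourierMultiplierCLM_add_apply
        ((hφ.isAnnularSymbol.lerayEntry_mul a b).hasTemperateGrowth_dyadicSymbol j) hn]
    have hsymb : (dyadicSymbol (fun ξ => lerayEntry a b ξ * φ ξ) j +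
        fun ξ => ξ b * ((ξ a / ‖ξ‖ ^ 2 : ℝ) * Φ ξ)) = if a = b then Φ else fun _ => 0 := by
      ext ξ
      rw [Pi.add_apply, dyadicSymbol_lerayEntry_mul, lerayEntry]
      split_ifs <;> push_cast <;> ring
    rw [hsymb]
    split_ifs
    · rfl
    · simp
  have hsum := Finset.sum_congr rfl fun b (_ : b ∈ Finset.univ) =>
    congrArg (fun f : VectorDistribution d => f u b) (hentry b)
  have hdiv := hg.sum_fourierMultiplierCLM_mul (hφ.hasTemperateGrowth_coord_div_normSq_mul a j) u
  rw [lerayProj_apply_apply, ← add_zero (∑ b, _), ← hdiv, ← Finset.sum_add_distrib]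
  refine hsum.trans ?_
  rw [Finset.sum_eq_single a (by simp +contextual [eq_comm]) (by simp)]
  simp

end IsLittlewoodPaley

end Leray

section RealValued

open TemperedDistribution ComplexConjugate

variable {d : ℕ} {φ : EuclideanSpace ℝ (Fin d) → ℝ}

theorem conj_fourier {E : Type*} [NormedAddCommGroup E] [InnerProductSpace ℝ E]
    [FiniteDimensional ℝ E] [MeasurableSpace E] [BorelSpace E] (f : E → ℂ) (x : E) :
    conj (𝓕 f x) = 𝓕 (fun ξ => conj (f (-ξ))) x := by
  rw [Real.fourier_eq, Real.fourier_eq, ← integral_conj,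
    ← integral_neg_eq_self (fun v => conj (Real.fourierChar (-inner ℝ v x) • f v))]
  refine integral_congr_ae (.of_forall fun ξ => ?_)
  simp only [Circle.smul_def, smul_eq_mul, map_mul, inner_neg_left, neg_neg,
    ← Circle.coe_inv_eq_conj, ← AddChar.map_neg_eq_inv]

theorem conj_fourierInv_apply {u : 𝓢(EuclideanSpace ℝ (Fin d), ℂ)} (hu : ∀ x, (u x).im = 0)
    (ξ : EuclideanSpace ℝ (Fin d)) : conj (𝓕⁻ u ξ) = 𝓕⁻ u (-ξ) := by
  simp only [SchwartzMap.fourierInv_coe, Real.fourierInv_eq_fourier_neg, conj_fourier,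
    Complex.conj_eq_iff_im.2 (hu _)]
  rw [← Real.fourierInv_eq_fourier_comp_neg, Real.fourierInv_eq_fourier_neg]

theorem IsRealValued.fourierMultiplierCLM {f : VectorDistribution d} (hf : IsRealValued f)
    {m : EuclideanSpace ℝ (Fin d) → ℂ} (hm : m.HasTemperateGrowth)
    (hconj : ∀ ξ, conj (m ξ) = m (-ξ)) :
    IsRealValued (fourierMultiplierCLM (EuclideanSpace ℂ (Fin d)) m f) := by
  intro u hu i
  rw [fourierMultiplierCLM_apply_apply]
  refine hf _ (fun x => ?_) i
  rw [← Complex.conj_eq_iff_im, SchwartzMap.fourier_coe, conj_fourier]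
  refine congrArg (fun v : EuclideanSpace ℝ (Fin d) → ℂ => 𝓕 v x) (funext fun ξ => ?_)
  simp only [SchwartzMap.smulLeftCLM_apply_apply hm, smul_eq_mul, map_mul, hconj,
    conj_fourierInv_apply hu, neg_neg]

theorem IsRealValued.dyadicMul {f : VectorDistribution d} (hf : IsRealValued f)
    {m : EuclideanSpace ℝ (Fin d) → ℝ} (hm : IsAnnularSymbol fun ξ => (m ξ : ℂ))
    (heven : m.Even) (j : ℤ) : IsRealValued (dyadicMul (fun ξ => (m ξ : ℂ)) j f) :=
  hf.fourierMultiplierCLM (hm.hasTemperateGrowth_dyadicSymbol j) fun ξ => by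
    simp only [dyadicSymbol, Complex.conj_ofReal, smul_neg, heven _]

theorem IsLittlewoodPaley.even (hφ : IsLittlewoodPaley φ) : φ.Even :=
  fun ξ => hφ.radial _ _ (norm_neg ξ)

theorem IsRealValued.lpProj (hφ : IsLittlewoodPaley φ) {f : VectorDistribution d}
    (hf : IsRealValued f) (j : ℤ) : IsRealValued (lpProj φ j f) :=
  hf.dyadicMul hφ.isAnnularSymbol hφ.even j

theorem lerayEntry_mul_fatten_even (hφ : IsLittlewoodPaley φ) (a b : Fin d) :
    (fun ξ => lerayEntry a b ξ * fatten φ ξ).Even := fun ξ => by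
  have h := lerayEntry_smul a b (neg_ne_zero.2 one_ne_zero) ξ
  simp only [neg_smul, one_smul] at h
  simp only [h, fatten, smul_neg, hφ.even _]

theorem IsRealValued.lerayProj (hφ : IsLittlewoodPaley φ) {f : VectorDistribution d}
    (hf : IsRealValued f) (j : ℤ) : IsRealValued (lerayProj φ j f) := by
  intro u hu a
  rw [lerayProj_apply_apply, Complex.im_sum]
  simp only [← Complex.ofReal_mul]
  exact Finset.sum_eq_zero fun b _ => hf.dyadicMul
    (by simpa using hφ.isAnnularSymbol_fatten.lerayEntry_mul a b)
    (lerayEntry_mul_fatten_even hφ a b) j u hu b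

theorem hasSum_apply_apply {ι : Type*} {f : ι → VectorDistribution d} {g : VectorDistribution d}
    (h : HasSum f g) (u : 𝓢(EuclideanSpace ℝ (Fin d), ℂ)) (i : Fin d) :
    HasSum (fun k => f k u i) (g u i) :=
  h.mapL ((EuclideanSpace.proj i : EuclideanSpace ℂ (Fin d) →L[ℂ] ℂ) ∘L
    PointwiseConvergenceCLM.evalCLM (RingHom.id ℂ) (EuclideanSpace ℂ (Fin d)) u)

theorem IsRealValued.of_hasSum {ι : Type*} {f : ι → VectorDistribution d}
    {g : VectorDistribution d} (h : HasSum f g) (hf : ∀ k, IsRealValued (f k)) :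
    IsRealValued g := fun u hu i => by
  have him := (hasSum_apply_apply h u i).mapL Complex.imCLM
  simp only [Complex.imCLM_apply, fun k => hf k u hu i] at him
  exact him.unique hasSum_zero

theorem IsDivFree.of_hasSum {ι : Type*} {f : ι → VectorDistribution d}
    {g : VectorDistribution d} (h : HasSum f g) (hf : ∀ k, IsDivFree (f k)) :
    IsDivFree g := fun u => by
  have hdiv := hasSum_sum (s := Finset.univ) fun i _ =>
    hasSum_apply_apply h (-∂_{EuclideanSpace.single i (1 : ℝ)} u) i
  have hzero (k : ι) : ∑ i, f k (-∂_{EuclideanSpace.single i (1 : ℝ)} u) i = 0 := hf k u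
  simp only [hzero] at hdiv
  exact hdiv.unique hasSum_zero

variable {p : ℝ≥0∞} [hp : Fact (1 ≤ p)]

theorem isRealValued_distOfLp_iff (F : VectorLp d p) :
    IsRealValued (distOfLp F) ↔ ∀ᵐ x, ∀ i, (F x i).im = 0 := by
  let L (i : Fin d) : EuclideanSpace ℂ (Fin d) →L[ℝ] ℝ := Complex.imCLM ∘L
    (EuclideanSpace.proj i : EuclideanSpace ℂ (Fin d) →L[ℂ] ℂ).restrictScalars ℝ
  have hL (i : Fin d) (u : 𝓢(EuclideanSpace ℝ (Fin d), ℂ)) :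
      (distOfLp F u i).im = ∫ x, L i (u x • F x) := by
    rw [(L i).integral_comp_comm (integrable_schwartz_smul u hp.out (Lp.memLp F)),
      ← distOfLp_apply]
    rfl
  rw [ae_all_iff]
  refine ⟨fun h i => ?_, fun h u hu i => ?_⟩
  · refine ae_eq_zero_of_integral_contDiff_smul_eq_zero
      (((L i).comp_memLp' (Lp.memLp F)).locallyIntegrable hp.out) fun g hg hgc => ?_
    have hgc' : HasCompactSupport (Complex.ofRealCLM ∘ g) := hgc.comp_left rfl
    have hg' : ContDiff ℝ (⊤ : ℕ∞) (Complex.ofRealCLM ∘ g) := by fun_prop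
    rw [← h (hgc'.toSchwartzMap hg') (fun x => by simp) i, hL]
    simp [L]
  · rw [hL]
    refine integral_eq_zero_of_ae ?_
    filter_upwards [h i] with x hx
    simp [L, hu x, hx]

end RealValued

section Truncation

theorem eLpNorm_le_rpow_mul_eLpNorm_rpow {α V W : Type*} [MeasurableSpace α] {μ : Measure α}
    [NormedAddCommGroup V] [NormedAddCommGroup W] {F : α → V} {G : α → W} {p q : ℝ} (hp : 0 < p)
    (hq : 0 < q) {c : ℝ≥0∞} (hF : AEStronglyMeasurable F μ)
    (h : ∀ᵐ x ∂μ, ‖G x‖ₑ ^ q ≤ c ^ (q - p) * ‖F x‖ₑ ^ p) :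
    eLpNorm G (ENNReal.ofReal q) μ ≤
      c ^ (1 - p / q) * eLpNorm F (ENNReal.ofReal p) μ ^ (p / q) := by
  rw [eLpNorm_eq_lintegral_rpow_enorm_toReal (by simpa using hq) ENNReal.ofReal_ne_top,
    eLpNorm_eq_lintegral_rpow_enorm_toReal (by simpa using hp) ENNReal.ofReal_ne_top,
    ENNReal.toReal_ofReal hq.le, ENNReal.toReal_ofReal hp.le]
  calc (∫⁻ x, ‖G x‖ₑ ^ q ∂μ) ^ (1 / q)
      ≤ (∫⁻ x, c ^ (q - p) * ‖F x‖ₑ ^ p ∂μ) ^ (1 / q) := by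
        gcongr 1
        exact lintegral_mono_ae h
    _ = (c ^ (q - p) * ∫⁻ x, ‖F x‖ₑ ^ p ∂μ) ^ (1 / q) := by
        rw [lintegral_const_mul'' _ (hF.enorm.pow_const p)]
    _ = c ^ (1 - p / q) * ((∫⁻ x, ‖F x‖ₑ ^ p ∂μ) ^ (1 / p)) ^ (p / q) := by
        rw [ENNReal.mul_rpow_of_nonneg _ _ (by positivity), ← ENNReal.rpow_mul,
          ← ENNReal.rpow_mul]
        congr 2 <;> field_simp

theorem eLpNorm_le_of_ae_enorm_le {α V : Type*} [MeasurableSpace α] {μ : Measure α}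
    [NormedAddCommGroup V] {F : α → V} (hF : AEStronglyMeasurable F μ) {p q : ℝ} (hp : 0 < p)
    (hpq : p ≤ q) {c : ℝ≥0∞} (hc : ∀ᵐ x ∂μ, ‖F x‖ₑ ≤ c) :
    eLpNorm F (ENNReal.ofReal q) μ ≤
      c ^ (1 - p / q) * eLpNorm F (ENNReal.ofReal p) μ ^ (p / q) := by
  refine eLpNorm_le_rpow_mul_eLpNorm_rpow hp (hp.trans_le hpq) hF ?_
  filter_upwards [hc] with x hx
  have hqp : 0 ≤ q - p := sub_nonneg.2 hpq
  calc ‖F x‖ₑ ^ q = ‖F x‖ₑ ^ (q - p) * ‖F x‖ₑ ^ p := by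
        rw [← ENNReal.rpow_add_of_nonneg _ _ hqp hp.le, sub_add_cancel]
    _ ≤ c ^ (q - p) * ‖F x‖ₑ ^ p := by gcongr

theorem eLpNorm_indicator_lt_enorm_le {α V : Type*} [MeasurableSpace α] {μ : Measure α}
    [NormedAddCommGroup V] {F : α → V} (hF : AEStronglyMeasurable F μ) {p q : ℝ} (hq : 0 < q)
    (hqp : q ≤ p) (c : ℝ≥0∞) :
    eLpNorm ({x | c < ‖F x‖ₑ}.indicator F) (ENNReal.ofReal q) μ ≤
      c ^ (1 - p / q) * eLpNorm F (ENNReal.ofReal p) μ ^ (p / q) := by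
  refine eLpNorm_le_rpow_mul_eLpNorm_rpow (hq.trans_le hqp) hq hF (.of_forall fun x => ?_)
  by_cases hx : c < ‖F x‖ₑ
  · rw [Set.indicator_of_mem (by exact hx)]
    calc ‖F x‖ₑ ^ q = ‖F x‖ₑ ^ (q - p) * ‖F x‖ₑ ^ p := by
          rw [← ENNReal.rpow_add _ _ (pos_of_gt hx).ne' enorm_ne_top, sub_add_cancel]
      _ ≤ c ^ (q - p) * ‖F x‖ₑ ^ p := by
          gcongr ?_ * _
          rw [← neg_sub p q, ENNReal.rpow_neg, ENNReal.rpow_neg]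
          gcongr
  · simp [Set.indicator_of_notMem (show x ∉ {x | c < ‖F x‖ₑ} from hx), hq]

variable {d : ℕ}

theorem distLpNorm_le_of_eLpNorm_le {p : ℝ≥0∞} {f : VectorDistribution d}
    {F : EuclideanSpace ℝ (Fin d) → EuclideanSpace ℂ (Fin d)} (hF : AEStronglyMeasurable F)
    (h : ∀ u : 𝓢(EuclideanSpace ℝ (Fin d), ℂ), f u = ∫ x, u x • F x) {c : ℝ≥0∞}
    (hc : eLpNorm F p ≤ c) : distLpNorm p f ≤ c := by
  rcases eq_top_or_lt_top c with rfl | hc'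
  · exact le_top
  · exact (distLpNorm_le_eLpNorm ⟨hF, hc.trans_lt hc'⟩ h).trans hc

theorem ae_eq_of_distOfLp_eq {p q : ℝ≥0∞} [hp : Fact (1 ≤ p)] [hq : Fact (1 ≤ q)]
    {F : VectorLp d p} {G : VectorLp d q} (h : distOfLp F = distOfLp G) : F =ᵐ[volume] G := by
  have hF := (Lp.memLp F).locallyIntegrable hp.out
  have hG := (Lp.memLp G).locallyIntegrable hq.out
  refine ae_eq_of_integral_contDiff_smul_eq hF hG fun g hg hgc => ?_
  have hgc' : HasCompactSupport (Complex.ofRealCLM ∘ g) := hgc.comp_left rfl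
  have hg' : ContDiff ℝ (⊤ : ℕ∞) (Complex.ofRealCLM ∘ g) := by fun_prop
  simpa [distOfLp_apply] using DFunLike.congr_fun h (hgc'.toSchwartzMap hg')

theorem distLpNorm_le_rpow_mul_rpow {f : VectorDistribution d} {p q : ℝ} (hp : 1 ≤ p)
    (hpq : p ≤ q) (hf : distLpNorm (ENNReal.ofReal p) f < ∞) (hf' : distLpNorm ∞ f < ∞) :
    distLpNorm (ENNReal.ofReal q) f ≤
      distLpNorm ∞ f ^ (1 - p / q) * distLpNorm (ENNReal.ofReal p) f ^ (p / q) := by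
  have : Fact (1 ≤ ENNReal.ofReal p) := ⟨ENNReal.one_le_ofReal.2 hp⟩
  obtain ⟨F, rfl⟩ := exists_distOfLp_eq hf
  obtain ⟨G, hG⟩ := exists_distOfLp_eq hf'
  have hbound : ∀ᵐ x, ‖F x‖ₑ ≤ ‖G‖ₑ := by
    rw [Lp.enorm_def, eLpNorm_exponent_top]
    filter_upwards [ae_eq_of_distOfLp_eq hG, enorm_ae_le_eLpNormEssSup G volume] with x hx hx'
    rwa [← hx]
  rw [← hG, distLpNorm_distOfLp, hG, distLpNorm_distOfLp, Lp.enorm_def F]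
  exact distLpNorm_le_of_eLpNorm_le (Lp.aestronglyMeasurable F) (distOfLp_apply F)
    (eLpNorm_le_of_ae_enorm_le (Lp.aestronglyMeasurable F) (by linarith) hpq hbound)

theorem isRealValued_distOfLp_indicator {p : ℝ≥0∞} [Fact (1 ≤ p)] {F : VectorLp d p}
    (hF : IsRealValued (distOfLp F)) {s : Set (EuclideanSpace ℝ (Fin d))} (hs : MeasurableSet s) :
    IsRealValued (distOfLp (((Lp.memLp F).indicator hs).toLp _)) := by
  rw [isRealValued_distOfLp_iff] at hF ⊢
  filter_upwards [hF, ((Lp.memLp F).indicator hs).coeFn_toLp] with x hx hx' i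
  rw [hx']
  by_cases hxs : x ∈ s
  · rw [Set.indicator_of_mem hxs, hx i]
  · rw [Set.indicator_of_notMem hxs, PiLp.zero_apply, Complex.zero_im]

theorem IsRealValued.exists_truncation {f : VectorDistribution d} (hf : IsRealValued f) {p : ℝ}
    (hp : 2 ≤ p) (hfp : distLpNorm (ENNReal.ofReal p) f < ∞) (c : ℝ≥0∞) :
    ∃ h b : VectorDistribution d, f = h + b ∧ IsRealValued h ∧ IsRealValued b ∧
      distLpNorm (ENNReal.ofReal p) h ≤ distLpNorm (ENNReal.ofReal p) f ∧
      distLpNorm (ENNReal.ofReal p) b ≤ distLpNorm (ENNReal.ofReal p) f ∧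
      distLpNorm 2 h ≤ c ^ (1 - p / 2) * distLpNorm (ENNReal.ofReal p) f ^ (p / 2) ∧
      distLpNorm ∞ b ≤ c := by
  have : Fact (1 ≤ ENNReal.ofReal p) := ⟨ENNReal.one_le_ofReal.2 (by linarith)⟩
  obtain ⟨F, rfl⟩ := exists_distOfLp_eq hfp
  have hF := (Lp.stronglyMeasurable F).aestronglyMeasurable (μ := volume)
  have hs : MeasurableSet {x | c < ‖F x‖ₑ} :=
    measurableSet_lt measurable_const (Lp.stronglyMeasurable F).enorm
  have hsc : ∀ x, ‖{x | c < ‖F x‖ₑ}ᶜ.indicator F x‖ₑ ≤ c := fun x => by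
    by_cases hx : c < ‖F x‖ₑ <;> simp [Set.indicator, hx, not_lt.1]
  have hind {s : Set (EuclideanSpace ℝ (Fin d))} (hs : MeasurableSet s)
      (u : 𝓢(EuclideanSpace ℝ (Fin d), ℂ)) :
      distOfLp (((Lp.memLp F).indicator hs).toLp _) u = ∫ x, u x • s.indicator F x := by
    rw [distOfLp_apply]
    refine integral_congr_ae ?_
    filter_upwards [((Lp.memLp F).indicator hs).coeFn_toLp] with x hx
    rw [hx]
  refine ⟨distOfLp (((Lp.memLp F).indicator hs).toLp _),
    distOfLp (((Lp.memLp F).indicator hs.compl).toLp _), ?_,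
    isRealValued_distOfLp_indicator hf hs, isRealValued_distOfLp_indicator hf hs.compl, ?_⟩
  · rw [← map_add, ← MemLp.toLp_add]
    exact congrArg distOfLp (by simp [Set.indicator_self_add_compl])
  rw [distLpNorm_distOfLp F, Lp.enorm_def]
  refine ⟨distLpNorm_le_of_eLpNorm_le (hF.indicator hs) (hind hs) (eLpNorm_indicator_le F),
    distLpNorm_le_of_eLpNorm_le (hF.indicator hs.compl) (hind hs.compl) (eLpNorm_indicator_le F),
    distLpNorm_le_of_eLpNorm_le (hF.indicator hs) (hind hs) ?_,
    distLpNorm_le_of_eLpNorm_le (hF.indicator hs.compl) (hind hs.compl) ?_⟩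
  · simpa using eLpNorm_indicator_lt_enorm_le hF two_pos hp c
  · rw [eLpNorm_exponent_top]
    exact eLpNormEssSup_le_of_ae_enorm_bound (.of_forall hsc)

end Truncation

section Synthesis

variable {d : ℕ} {φ : EuclideanSpace ℝ (Fin d) → ℝ} {B : ℤ → VectorDistribution d}
  {f : VectorDistribution d}

theorem lpProj_eq_sum_of_hasSum (hB : ∀ j, IsDyadicBlock φ j (B j)) (h : HasSum B f) (k : ℤ) :
    lpProj φ k f = ∑ i ∈ Finset.Icc (-2 : ℤ) 2, lpProj φ k (B (k - i)) := by
  have hk : HasSum (fun j => lpProj φ k (B j)) (lpProj φ k f) :=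
    h.mapL (dyadicMul (fun ξ => (φ ξ : ℂ)) k)
  rw [← (Equiv.subLeft k).hasSum_iff] at hk
  refine hk.unique (hasSum_sum_of_ne_finset_zero fun i hi => ?_)
  simpa using (hB (k - i)).lpProj_eq_zero i hi

theorem IsLittlewoodPaley.exists_distLpNorm_lpProj_le (hφ : IsLittlewoodPaley φ) :
    ∃ C : ℝ≥0, ∀ (j : ℤ) (p : ℝ≥0∞) [Fact (1 ≤ p)] (f : VectorDistribution d),
      distLpNorm p (lpProj φ j f) ≤ C * distLpNorm p f :=
  hφ.isAnnularSymbol.exists_distLpNorm_dyadicMul_le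

theorem IsLittlewoodPaley.hasSum_lpProj_of_hasSum (hφ : IsLittlewoodPaley φ)
    (hB : ∀ j, IsDyadicBlock φ j (B j)) (h : HasSum B f) {p : ℝ≥0∞} [Fact (1 ≤ p)]
    (hp : ∑' j, distLpNorm p (B j) < ∞) : HasSum (fun k => lpProj φ k f) f := by
  obtain ⟨C, hC⟩ := hφ.exists_distLpNorm_lpProj_le
  have hshift (i : ℤ) : ∃ S, HasSum (fun j => lpProj φ (j + i) (B j)) S := by
    have hlt : ∑' j, distLpNorm p (lpProj φ (j + i) (B j)) < ∞ :=
      (ENNReal.tsum_le_tsum fun j => hC (j + i) p (B j)).trans_lt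
        (ENNReal.tsum_mul_left.trans_lt (ENNReal.mul_lt_top ENNReal.coe_lt_top hp))
    obtain ⟨S, hS, -⟩ := exists_hasSum_distLpNorm_le_tsum hlt
    exact ⟨S, hS⟩
  choose S hS using hshift
  have hS_sum : ∑ i ∈ Finset.Icc (-2 : ℤ) 2, S i = f := by
    have hsum := hasSum_sum (s := Finset.Icc (-2 : ℤ) 2) fun i _ => hS i
    simp only [(hB _).sum_lpProj] at hsum
    exact hsum.unique h
  have hS' (i : ℤ) : HasSum (fun k => lpProj φ k (B (k - i))) (S i) := by
    simpa [Function.comp_def] using (Equiv.subRight i).hasSum_iff.2 (hS i)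
  simpa only [lpProj_eq_sum_of_hasSum hB h, hS_sum] using
    hasSum_sum (s := Finset.Icc (-2 : ℤ) 2) fun i _ => hS' i

end Synthesis

section SequenceNorms

variable {q : ℝ≥0∞}

theorem seqNorm_eq_eLpNorm_count (hq : q ≠ 0) (a : ℤ → ℝ≥0∞) :
    seqNorm q a = eLpNorm a q Measure.count := by
  unfold seqNorm
  split_ifs with h
  · simp [h]
  · simp [eLpNorm_eq_lintegral_rpow_enorm_toReal hq h, lintegral_count]

theorem seqNorm_mono {a b : ℤ → ℝ≥0∞} (h : ∀ j, a j ≤ b j) : seqNorm q a ≤ seqNorm q b := by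
  unfold seqNorm
  split_ifs
  · exact iSup_mono h
  · gcongr with j
    exact h j

theorem seqNorm_const_mul (hq : q ≠ 0) (c : ℝ≥0∞) (a : ℤ → ℝ≥0∞) :
    seqNorm q (fun j => c * a j) = c * seqNorm q a := by
  unfold seqNorm
  split_ifs with h
  · rw [ENNReal.mul_iSup]
  · have hq' : 0 < q.toReal := ENNReal.toReal_pos hq h
    simp only [ENNReal.mul_rpow_of_nonneg _ _ hq'.le, ENNReal.tsum_mul_left]
    rw [ENNReal.mul_rpow_of_nonneg _ _ (by positivity), ← ENNReal.rpow_mul,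
      mul_one_div_cancel hq'.ne', ENNReal.rpow_one]

theorem seqNorm_comp_sub (a : ℤ → ℝ≥0∞) (i : ℤ) : seqNorm q (fun j => a (j - i)) = seqNorm q a := by
  unfold seqNorm
  split_ifs
  · exact (Equiv.subRight i).iSup_comp (g := a)
  · exact congrArg (· ^ (1 / q.toReal)) ((Equiv.subRight i).tsum_eq fun j => a j ^ q.toReal)

theorem seqNorm_sum_comp_sub_le (hq : 1 ≤ q) (s : Finset ℤ) (a : ℤ → ℝ≥0∞) :
    seqNorm q (fun k => ∑ i ∈ s, a (k - i)) ≤ s.card * seqNorm q a := by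
  have hq0 : q ≠ 0 := (zero_lt_one.trans_le hq).ne'
  calc seqNorm q (fun k => ∑ i ∈ s, a (k - i))
      = eLpNorm (∑ i ∈ s, fun k => a (k - i)) q Measure.count := by
        rw [seqNorm_eq_eLpNorm_count hq0]
        congr 1 with k
        simp
    _ ≤ ∑ i ∈ s, eLpNorm (fun k => a (k - i)) q Measure.count :=
        eLpNorm_sum_le (fun i _ => (measurable_of_countable _).aestronglyMeasurable) hq
    _ = s.card * seqNorm q a := by
        simp only [← seqNorm_eq_eLpNorm_count hq0, seqNorm_comp_sub, Finset.sum_const,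
          nsmul_eq_mul]

theorem tsum_two_rpow_neg_abs_lt_top {η : ℝ} (hη : 0 < η) :
    ∑' j : ℤ, (2 : ℝ≥0∞) ^ (-(η * |(j : ℝ)|)) < ∞ := by
  have hnat : Summable fun n : ℕ => (2 : ℝ) ^ (-(η * n)) := by
    simp only [← neg_mul, Real.rpow_mul zero_le_two, Real.rpow_natCast]
    exact summable_geometric_of_lt_one (by positivity)
      (Real.rpow_lt_one_of_one_lt_of_neg one_lt_two (by linarith))
  have hint : Summable fun j : ℤ => (2 : ℝ) ^ (-(η * |(j : ℝ)|)) :=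
    .of_nat_of_neg (by simpa using hnat) (by simpa using hnat)
  simp only [← ENNReal.ofReal_ofNat 2, ENNReal.ofReal_rpow_of_pos two_pos]
  rw [← ENNReal.ofReal_tsum_of_nonneg (fun j => by positivity) hint]
  exact ENNReal.ofReal_lt_top

theorem seqNorm_two_rpow_neg_abs_lt_top (hq : q ≠ 0) {η : ℝ} (hη : 0 < η) :
    seqNorm q (fun j => (2 : ℝ≥0∞) ^ (-(η * |(j : ℝ)|))) < ∞ := by
  unfold seqNorm
  split_ifs with h
  · refine (iSup_le fun j => ?_).trans_lt ENNReal.one_lt_top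
    calc (2 : ℝ≥0∞) ^ (-(η * |(j : ℝ)|)) ≤ 2 ^ (0 : ℝ) :=
          ENNReal.rpow_le_rpow_of_exponent_le one_le_two (by simpa using by positivity)
      _ = 1 := ENNReal.rpow_zero
  · have hq' : 0 < q.toReal := ENNReal.toReal_pos hq h
    refine ENNReal.rpow_lt_top_of_nonneg (by positivity) (LT.lt.ne ?_)
    simp only [← ENNReal.rpow_mul]
    convert tsum_two_rpow_neg_abs_lt_top (mul_pos hη hq') using 4
    ring

end SequenceNorms

section BesovBounds

variable {d : ℕ} {φ : EuclideanSpace ℝ (Fin d) → ℝ}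

theorem besovNorm_eq_seqNorm (s : ℝ) (p q : ℝ≥0∞) (f : VectorDistribution d) :
    besovNorm φ s p q f =
      seqNorm q fun j => (2 : ℝ≥0∞) ^ (j * s) * distLpNorm p (lpProj φ j f) := by
  simp only [besovNorm, ← ENNReal.ofReal_rpow_of_pos two_pos, ENNReal.ofReal_ofNat]

theorem two_rpow_mul_le_of_mem_Icc {i : ℤ} (hi : i ∈ Finset.Icc (-2 : ℤ) 2) (k : ℤ) (s : ℝ) :
    (2 : ℝ≥0∞) ^ (k * s) ≤ 2 ^ (2 * |s|) * 2 ^ ((k - i : ℤ) * s) := by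
  obtain ⟨h₁, h₂⟩ : (-2 : ℝ) ≤ i ∧ (i : ℝ) ≤ 2 := by exact_mod_cast Finset.mem_Icc.1 hi
  have his : i * s ≤ 2 * |s| :=
    (le_abs_self _).trans (abs_mul (i : ℝ) s ▸ by gcongr; exact abs_le.2 ⟨h₁, h₂⟩)
  rw [← ENNReal.rpow_add _ _ two_ne_zero ENNReal.ofNat_ne_top]
  refine ENNReal.rpow_le_rpow_of_exponent_le one_le_two ?_
  push_cast
  linarith

theorem IsLittlewoodPaley.exists_besovNorm_le (hφ : IsLittlewoodPaley φ) (s : ℝ) :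
    ∃ C : ℝ≥0, ∀ (B : ℤ → VectorDistribution d) (f : VectorDistribution d),
      (∀ j, IsDyadicBlock φ j (B j)) → HasSum B f →
      ∀ (p q : ℝ≥0∞) [Fact (1 ≤ p)], 1 ≤ q →
        besovNorm φ s p q f ≤ C * seqNorm q fun j => (2 : ℝ≥0∞) ^ (j * s) * distLpNorm p (B j) := by
  obtain ⟨C, hC⟩ := hφ.exists_distLpNorm_lpProj_le
  refine ⟨C * 2 ^ (2 * |s|) * 5, fun B f hB h p q _ hq => ?_⟩
  set v : ℤ → ℝ≥0∞ := fun j => 2 ^ (j * s) * distLpNorm p (B j) with hv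
  have hblock (k : ℤ) : 2 ^ (k * s) * distLpNorm p (lpProj φ k f) ≤
      C * 2 ^ (2 * |s|) * ∑ i ∈ Finset.Icc (-2 : ℤ) 2, v (k - i) := by
    rw [lpProj_eq_sum_of_hasSum hB h]
    calc 2 ^ (k * s) * distLpNorm p (∑ i ∈ Finset.Icc (-2 : ℤ) 2, lpProj φ k (B (k - i)))
        ≤ 2 ^ (k * s) * ∑ i ∈ Finset.Icc (-2 : ℤ) 2, C * distLpNorm p (B (k - i)) := by
          gcongr
          exact (distLpNorm_sum_le _ _).trans (Finset.sum_le_sum fun i _ => hC k p _)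
      _ ≤ ∑ i ∈ Finset.Icc (-2 : ℤ) 2, C * 2 ^ (2 * |s|) * v (k - i) := by
          rw [Finset.mul_sum]
          refine Finset.sum_le_sum fun i hi => ?_
          calc _ ≤ 2 ^ (2 * |s|) * 2 ^ ((k - i : ℤ) * s) * (C * distLpNorm p (B (k - i))) := by
                gcongr
                exact two_rpow_mul_le_of_mem_Icc hi k s
            _ = C * 2 ^ (2 * |s|) * v (k - i) := by rw [hv]; ring
      _ = _ := by rw [Finset.mul_sum]
  calc besovNorm φ s p q f
      ≤ seqNorm q fun k => C * 2 ^ (2 * |s|) * ∑ i ∈ Finset.Icc (-2 : ℤ) 2, v (k - i) :=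
        (besovNorm_eq_seqNorm s p q f).trans_le (seqNorm_mono hblock)
    _ ≤ C * 2 ^ (2 * |s|) * (5 * seqNorm q v) := by
        rw [seqNorm_const_mul (zero_lt_one.trans_le hq).ne']
        gcongr
        simpa using seqNorm_sum_comp_sub_le hq (Finset.Icc (-2 : ℤ) 2) v
    _ = _ := by
        rw [← mul_assoc]
        push_cast [ENNReal.coe_rpow_of_nonneg _ (by positivity : (0 : ℝ) ≤ 2 * |s|)]
        rfl

end BesovBounds

section BlockSplitting

variable {d : ℕ}

theorem two_rpow_mul_lt_top (x : ℝ) {M : ℝ≥0∞} (hM : M ≠ ∞) : 2 ^ x * M < ∞ :=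
  ENNReal.mul_lt_top (lt_top_iff_ne_top.2 (by simp)) hM.lt_top

theorem two_rpow_mul_rpow_mul_rpow {M : ℝ≥0∞} (hM : M ≠ ∞) (a b : ℝ) {s t : ℝ} (hst : s + t = 1)
    (ht : 0 < t) : (2 ^ a * M) ^ s * (2 ^ b * M) ^ t = 2 ^ (a * s + b * t) * M := by
  rcases eq_or_ne M 0 with rfl | hM0
  · simp [ENNReal.zero_rpow_of_pos ht]
  have h2 (x : ℝ) : (2 : ℝ≥0∞) ^ x ≠ 0 := by simp
  have hMst : M ^ s * M ^ t = M := by rw [← ENNReal.rpow_add _ _ hM0 hM, hst, ENNReal.rpow_one]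
  rw [ENNReal.mul_rpow_of_ne_zero (h2 a) hM0, ENNReal.mul_rpow_of_ne_zero (h2 b) hM0,
    mul_mul_mul_comm, hMst, ← ENNReal.rpow_mul, ← ENNReal.rpow_mul,
    ← ENNReal.rpow_add _ _ two_ne_zero ENNReal.ofNat_ne_top]

theorem IsRealValued.exists_split {f : VectorDistribution d} (hf : IsRealValued f) {p : ℝ}
    (hp : 2 ≤ p) {M : ℝ≥0∞} (hM : M ≠ ∞) {j : ℤ}
    (hfp : distLpNorm (ENNReal.ofReal p) f ≤ 2 ^ (-(j * critReg d p)) * M)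
    (hf_top : distLpNorm ∞ f ≤ 2 ^ (j : ℝ) * M) (κ : ℝ) (J : ℤ) :
    ∃ h b : VectorDistribution d, f = h + b ∧ IsRealValued h ∧ IsRealValued b ∧
      distLpNorm (ENNReal.ofReal p) h ≤ distLpNorm (ENNReal.ofReal p) f ∧
      distLpNorm (ENNReal.ofReal p) b ≤ distLpNorm (ENNReal.ofReal p) f ∧
      distLpNorm 2 h ≤
        2 ^ (-((d / 2 - 1) * J) - (d / 2 - 1 - κ * (p / 2 - 1)) * |(j : ℝ) - J|) * M ∧
      distLpNorm ∞ b ≤ 2 ^ (j - κ * max ((j : ℝ) - J) 0) * M := by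
  have : Fact (1 ≤ ENNReal.ofReal p) := ⟨ENNReal.one_le_ofReal.2 (by linarith)⟩
  have hfp_lt : distLpNorm (ENNReal.ofReal p) f < ∞ :=
    hfp.trans_lt (two_rpow_mul_lt_top _ hM)
  rcases lt_or_ge j J with hjJ | hjJ
  · have hjJ' : (j : ℝ) - J ≤ 0 := sub_nonpos.2 (by exact_mod_cast hjJ.le)
    refine ⟨0, f, (zero_add f).symm, fun u _ i => rfl, hf, ?_, le_rfl, ?_, ?_⟩
    · exact distLpNorm_zero.trans_le zero_le
    · exact distLpNorm_zero.trans_le zero_le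
    · simpa [max_eq_right hjJ'] using hf_top
  · have hjJ' : 0 ≤ (j : ℝ) - J := sub_nonneg.2 (by exact_mod_cast hjJ)
    obtain ⟨h, b, hfhb, hh, hb, hhp, hbp, hh2, hb_top⟩ :=
      hf.exists_truncation hp hfp_lt (2 ^ (j - κ * ((j : ℝ) - J)) * M)
    refine ⟨h, b, hfhb, hh, hb, hhp, hbp, ?_, by rwa [max_eq_left hjJ']⟩
    calc distLpNorm 2 h
        ≤ (2 ^ (j - κ * ((j : ℝ) - J)) * M) ^ (1 - p / 2) *
            (2 ^ (-(j * critReg d p)) * M) ^ (p / 2) := hh2.trans (by gcongr)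
      _ = 2 ^ (-((d / 2 - 1) * J) - (d / 2 - 1 - κ * (p / 2 - 1)) * |(j : ℝ) - J|) * M := by
          rw [two_rpow_mul_rpow_mul_rpow hM _ _ (by ring) (by positivity), abs_of_nonneg hjJ']
          congr 2
          rw [critReg]
          field_simp
          ring

theorem two_rpow_mul_distLpNorm_le {b : VectorDistribution d} {p q : ℝ} (hp : 1 ≤ p) (hpq : p ≤ q)
    {M : ℝ≥0∞} (hM : M ≠ ∞) {j J : ℤ} {κ δ η : ℝ} (hη : η ≤ δ) (hη' : η ≤ κ * (1 - p / q) - δ)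
    (hbp : distLpNorm (ENNReal.ofReal p) b ≤ 2 ^ (-(j * critReg d p)) * M)
    (hb_top : distLpNorm ∞ b ≤ 2 ^ (j - κ * max ((j : ℝ) - J) 0) * M) :
    2 ^ (j * (critReg d q + δ)) * distLpNorm (ENNReal.ofReal q) b ≤
      2 ^ (δ * J - η * |(j : ℝ) - J|) * M := by
  have hp0 : 0 < p := zero_lt_one.trans_le hp
  have hq0 : 0 < q := hp0.trans_le hpq
  have hθ : 0 ≤ 1 - p / q := sub_nonneg.2 ((div_le_one hq0).2 hpq)
  have hexp : j * (critReg d q + δ) +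
      ((j - κ * max ((j : ℝ) - J) 0) * (1 - p / q) + -(j * critReg d p) * (p / q)) =
        j * δ - κ * (1 - p / q) * max ((j : ℝ) - J) 0 := by
    rw [critReg, critReg]
    field_simp
    ring
  calc 2 ^ (j * (critReg d q + δ)) * distLpNorm (ENNReal.ofReal q) b
      ≤ 2 ^ (j * (critReg d q + δ)) * ((2 ^ (j - κ * max ((j : ℝ) - J) 0) * M) ^ (1 - p / q) *
          (2 ^ (-(j * critReg d p)) * M) ^ (p / q)) := by
        gcongr
        exact (distLpNorm_le_rpow_mul_rpow hp hpq (hbp.trans_lt (two_rpow_mul_lt_top _ hM))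
          (hb_top.trans_lt (two_rpow_mul_lt_top _ hM))).trans (by gcongr)
    _ = 2 ^ (j * δ - κ * (1 - p / q) * max ((j : ℝ) - J) 0) * M := by
        rw [two_rpow_mul_rpow_mul_rpow hM _ _ (by ring) (by positivity), ← mul_assoc,
          ← ENNReal.rpow_add _ _ two_ne_zero ENNReal.ofNat_ne_top, hexp]
    _ ≤ 2 ^ (δ * J - η * |(j : ℝ) - J|) * M := by
        gcongr ?_ * M
        refine ENNReal.rpow_le_rpow_of_exponent_le one_le_two ?_
        rcases le_total ((j : ℝ) - J) 0 with h | h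
        · rw [max_eq_right h, abs_of_nonpos h]
          nlinarith
        · rw [max_eq_left h, abs_of_nonneg h]
          nlinarith

end BlockSplitting

section SolenoidalSplitting

variable {d : ℕ} {φ : EuclideanSpace ℝ (Fin d) → ℝ}

theorem two_rpow_mul_distLpNorm_lpProj_le_besovNorm (s : ℝ) (p : ℝ≥0∞) (g : VectorDistribution d)
    (j : ℤ) : 2 ^ (j * s) * distLpNorm p (lpProj φ j g) ≤ besovNorm φ s p ∞ g := by
  rw [besovNorm_eq_seqNorm, seqNorm, if_pos rfl]
  exact le_iSup (fun j : ℤ => (2 : ℝ≥0∞) ^ (j * s) * distLpNorm p (lpProj φ j g)) j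

theorem distLpNorm_lpProj_le_besovNorm (s : ℝ) (p : ℝ≥0∞) (g : VectorDistribution d) (j : ℤ) :
    distLpNorm p (lpProj φ j g) ≤ 2 ^ (-(j * s)) * besovNorm φ s p ∞ g := by
  calc distLpNorm p (lpProj φ j g)
      = 2 ^ (-(j * s)) * (2 ^ (j * s) * distLpNorm p (lpProj φ j g)) := by
        rw [← mul_assoc, ← ENNReal.rpow_add _ _ two_ne_zero ENNReal.ofNat_ne_top]
        simp
    _ ≤ 2 ^ (-(j * s)) * besovNorm φ s p ∞ g := by
        gcongr
        exact two_rpow_mul_distLpNorm_lpProj_le_besovNorm s p g j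

theorem IsLittlewoodPaley.exists_distLpNorm_top_lpProj_le (hφ : IsLittlewoodPaley φ) {p : ℝ}
    (hp : 1 ≤ p) : ∃ C : ℝ≥0, ∀ g : VectorDistribution d,
      besovNorm φ (critReg d p) (ENNReal.ofReal p) ∞ g < ∞ → ∀ j : ℤ,
      distLpNorm ∞ (lpProj φ j g) ≤
        2 ^ (j : ℝ) * (C * besovNorm φ (critReg d p) (ENNReal.ofReal p) ∞ g) := by
  have : Fact (1 ≤ ENNReal.ofReal p) := ⟨ENNReal.one_le_ofReal.2 hp⟩
  obtain ⟨C, hC⟩ :=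
    hφ.isAnnularSymbol_fatten.exists_distLpNorm_top_dyadicMul_le (ENNReal.ofReal p)
  refine ⟨C, fun g hg j => ?_⟩
  have hblock := distLpNorm_lpProj_le_besovNorm (φ := φ) (critReg d p) (ENNReal.ofReal p) g j
  have hfatten : dyadicMul (fun ξ => (fatten φ ξ : ℂ)) j (lpProj φ j g) = lpProj φ j g := by
    simpa [← lpProj_eq_dyadicMul] using hφ.dyadicMul_mul_fatten_lpProj (m := fun _ => 1)
      (by simpa using hφ.isAnnularSymbol_fatten) j g
  have hexp : (j : ℝ) = j * (d * p⁻¹) + -(j * critReg d p) := by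
    rw [critReg, div_eq_mul_inv]
    ring
  calc distLpNorm ∞ (lpProj φ j g)
      ≤ C * 2 ^ (j * (d * p⁻¹)) * distLpNorm (ENNReal.ofReal p) (lpProj φ j g) := by
        simpa [hfatten, ENNReal.toReal_ofReal (zero_le_one.trans hp)] using
          hC j _ (hblock.trans_lt (two_rpow_mul_lt_top _ hg.ne))
    _ ≤ C * 2 ^ (j * (d * p⁻¹)) *
          (2 ^ (-(j * critReg d p)) * besovNorm φ (critReg d p) (ENNReal.ofReal p) ∞ g) := by
        gcongr
    _ = 2 ^ (j : ℝ) * (C * besovNorm φ (critReg d p) (ENNReal.ofReal p) ∞ g) := by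
        conv_rhs => rw [hexp, ENNReal.rpow_add _ _ two_ne_zero ENNReal.ofNat_ne_top]
        ring

/-- A dyadic block that is real-valued and divergence-free; both parts of the splitting are sums of
such blocks. -/
structure IsSolenoidalBlock (φ : EuclideanSpace ℝ (Fin d) → ℝ) (j : ℤ)
    (f : VectorDistribution d) : Prop extends IsDyadicBlock φ j f where
  isRealValued : IsRealValued f
  isDivFree : IsDivFree f

theorem IsLittlewoodPaley.isSolenoidalBlock_lerayProj (hφ : IsLittlewoodPaley φ)
    {f : VectorDistribution d} (hf : IsRealValued f) (j : ℤ) :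
    IsSolenoidalBlock φ j (lerayProj φ j f) :=
  ⟨hφ.isDyadicBlock_lerayProj j f, hf.lerayProj hφ j, hφ.isDivFree_lerayProj j f⟩

theorem IsLittlewoodPaley.exists_mul_distLpNorm_lerayProj_le (hφ : IsLittlewoodPaley φ) :
    ∃ C : ℝ≥0, ∀ (j : ℤ) (p : ℝ≥0∞) [Fact (1 ≤ p)] (f : VectorDistribution d) (a b : ℝ)
      {M : ℝ≥0∞}, M ≠ ∞ → 2 ^ a * distLpNorm p f ≤ 2 ^ b * M →
        2 ^ a * distLpNorm p (lerayProj φ j f) ≤ C * M * 2 ^ b := by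
  obtain ⟨C, hC⟩ := hφ.exists_distLpNorm_lerayProj_le
  refine ⟨C, fun j p _ f a b M hM h => ?_⟩
  have hf : distLpNorm p f < ∞ :=
    ENNReal.lt_top_of_mul_ne_top_right (h.trans_lt (two_rpow_mul_lt_top b hM)).ne (by simp)
  calc 2 ^ a * distLpNorm p (lerayProj φ j f)
      ≤ 2 ^ a * (C * distLpNorm p f) := by gcongr; exact hC j p f hf
    _ = C * (2 ^ a * distLpNorm p f) := by ring
    _ ≤ C * (2 ^ b * M) := by gcongr
    _ = C * M * 2 ^ b := by ring

theorem IsLittlewoodPaley.exists_solenoidal_split (hφ : IsLittlewoodPaley φ) {p q : ℝ}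
    (hp : 2 ≤ p) (hpq : p ≤ q) {κ δ η : ℝ} (hη : η ≤ δ) (hη' : η ≤ κ * (1 - p / q) - δ) :
    ∃ K : ℝ≥0, ∀ g : VectorDistribution d, IsRealValued g → IsDivFree g →
      besovNorm φ (critReg d p) (ENNReal.ofReal p) ∞ g < ∞ → ∀ J j : ℤ,
      ∃ h b : VectorDistribution d, lpProj φ j g = h + b ∧
        IsSolenoidalBlock φ j h ∧ IsSolenoidalBlock φ j b ∧
        2 ^ (j * critReg d p) * distLpNorm (ENNReal.ofReal p) h ≤
          K * besovNorm φ (critReg d p) (ENNReal.ofReal p) ∞ g ∧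
        2 ^ (j * critReg d p) * distLpNorm (ENNReal.ofReal p) b ≤
          K * besovNorm φ (critReg d p) (ENNReal.ofReal p) ∞ g ∧
        distLpNorm 2 h ≤ K * besovNorm φ (critReg d p) (ENNReal.ofReal p) ∞ g *
          2 ^ (-((d / 2 - 1) * J) - (d / 2 - 1 - κ * (p / 2 - 1)) * |(j : ℝ) - J|) ∧
        2 ^ (j * (critReg d q + δ)) * distLpNorm (ENNReal.ofReal q) b ≤
          K * besovNorm φ (critReg d p) (ENNReal.ofReal p) ∞ g *
            2 ^ (δ * J - η * |(j : ℝ) - J|) := by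
  have : Fact (1 ≤ ENNReal.ofReal p) := ⟨ENNReal.one_le_ofReal.2 (by linarith)⟩
  have : Fact (1 ≤ ENNReal.ofReal q) := ⟨ENNReal.one_le_ofReal.2 (by linarith)⟩
  obtain ⟨C, hC⟩ := hφ.exists_distLpNorm_top_lpProj_le (by linarith : 1 ≤ p)
  obtain ⟨L, hL⟩ := hφ.exists_mul_distLpNorm_lerayProj_le
  refine ⟨L * (C + 1), fun g hgr hgd hg J j => ?_⟩
  set M := besovNorm φ (critReg d p) (ENNReal.ofReal p) ∞ g
  have hM : (C + 1) * M ≠ ∞ := ENNReal.mul_ne_top (by simp) hg.ne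
  have hM_le : M ≤ (C + 1) * M := le_mul_of_one_le_left zero_le le_add_self
  have hgp : distLpNorm (ENNReal.ofReal p) (lpProj φ j g) ≤
      2 ^ (-(j * critReg d p)) * ((C + 1) * M) :=
    (distLpNorm_lpProj_le_besovNorm _ _ g j).trans (by gcongr)
  have hg_top : distLpNorm ∞ (lpProj φ j g) ≤ 2 ^ (j : ℝ) * ((C + 1) * M) :=
    (hC g hg j).trans (by gcongr; exact le_self_add)
  obtain ⟨h, b, hsum, hhr, hbr, hhp, hbp, hh2, hb_top⟩ :=
    (hgr.lpProj hφ j).exists_split hp hM hgp hg_top κ J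
  have hbq := two_rpow_mul_distLpNorm_le (by linarith) hpq hM hη hη' (hbp.trans hgp) hb_top
  have hp_bound {u : VectorDistribution d}
      (hu : distLpNorm (ENNReal.ofReal p) u ≤ distLpNorm (ENNReal.ofReal p) (lpProj φ j g)) :
      2 ^ (j * critReg d p) * distLpNorm (ENNReal.ofReal p) u ≤ 2 ^ (0 : ℝ) * ((C + 1) * M) := by
    rw [ENNReal.rpow_zero, one_mul]
    exact (mul_le_mul_right hu _).trans
      ((two_rpow_mul_distLpNorm_lpProj_le_besovNorm _ _ g j).trans hM_le)
  simp only [ENNReal.coe_mul, ENNReal.coe_add, ENNReal.coe_one, mul_assoc (L : ℝ≥0∞)]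
  refine ⟨lerayProj φ j h, lerayProj φ j b, ?_, hφ.isSolenoidalBlock_lerayProj hhr j,
    hφ.isSolenoidalBlock_lerayProj hbr j, ?_, ?_, ?_, ?_⟩
  · rw [← map_add, ← hsum, hφ.lerayProj_lpProj hgd]
  · simpa [mul_assoc] using hL j _ h _ 0 hM (hp_bound hhp)
  · simpa [mul_assoc] using hL j _ b _ 0 hM (hp_bound hbp)
  · simpa [mul_assoc] using hL j 2 h 0 _ hM (by simpa using hh2)
  · simpa [mul_assoc] using hL j _ b _ _ hM hbq

end SolenoidalSplitting

section Decomposition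

variable {d : ℕ} {φ : EuclideanSpace ℝ (Fin d) → ℝ}

theorem exists_seqNorm_le_of_le_two_rpow {q : ℝ≥0∞} (hq : q ≠ 0) {η : ℝ} (hη : 0 < η) :
    ∃ S : ℝ≥0, ∀ (v : ℤ → ℝ≥0∞) (A : ℝ≥0∞) (a : ℝ) (J : ℤ),
      (∀ j : ℤ, v j ≤ A * 2 ^ (a - η * |(j : ℝ) - J|)) → seqNorm q v ≤ S * (A * 2 ^ a) := by
  lift seqNorm q (fun j => (2 : ℝ≥0∞) ^ (-(η * |(j : ℝ)|))) to ℝ≥0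
    using (seqNorm_two_rpow_neg_abs_lt_top hq hη).ne with S hS
  refine ⟨S, fun v A a J hv => ?_⟩
  calc seqNorm q v
      ≤ seqNorm q fun j => A * 2 ^ a * (2 : ℝ≥0∞) ^ (-(η * |((j - J : ℤ) : ℝ)|)) := by
        refine seqNorm_mono fun j => (hv j).trans_eq ?_
        rw [sub_eq_add_neg, ENNReal.rpow_add _ _ two_ne_zero ENNReal.ofNat_ne_top, mul_assoc,
          Int.cast_sub]
    _ = S * (A * 2 ^ a) := by
        rw [seqNorm_const_mul hq, seqNorm_comp_sub fun j => (2 : ℝ≥0∞) ^ (-(η * |(j : ℝ)|)), ← hS,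
          mul_comm]

theorem seqNorm_one (a : ℤ → ℝ≥0∞) : seqNorm 1 a = ∑' j, a j := by
  simp [seqNorm]

theorem IsLittlewoodPaley.exists_besovNorm_top_le (hφ : IsLittlewoodPaley φ) (s : ℝ) (p : ℝ≥0∞)
    [Fact (1 ≤ p)] : ∃ C : ℝ≥0, ∀ (B : ℤ → VectorDistribution d) (f : VectorDistribution d)
      (A : ℝ≥0∞), (∀ j, IsDyadicBlock φ j (B j)) → HasSum B f →
      (∀ j : ℤ, 2 ^ (j * s) * distLpNorm p (B j) ≤ A) → besovNorm φ s p ∞ f ≤ C * A := by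
  obtain ⟨C, hC⟩ := hφ.exists_besovNorm_le s
  refine ⟨C, fun B f A hB hf hA => (hC B f hB hf p ∞ le_top).trans ?_⟩
  rw [seqNorm, if_pos rfl]
  gcongr
  exact iSup_le hA

theorem IsLittlewoodPaley.exists_besovNorm_le_of_le_two_rpow (hφ : IsLittlewoodPaley φ) (s : ℝ)
    (p : ℝ≥0∞) [Fact (1 ≤ p)] {q : ℝ≥0∞} (hq : 1 ≤ q) {η : ℝ} (hη : 0 < η) :
    ∃ C : ℝ≥0, ∀ (B : ℤ → VectorDistribution d) (f : VectorDistribution d) (A : ℝ≥0∞) (a : ℝ)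
      (J : ℤ), (∀ j, IsDyadicBlock φ j (B j)) → HasSum B f →
      (∀ j : ℤ, 2 ^ (j * s) * distLpNorm p (B j) ≤ A * 2 ^ (a - η * |(j : ℝ) - J|)) →
      besovNorm φ s p q f ≤ C * (A * 2 ^ a) := by
  obtain ⟨C, hC⟩ := hφ.exists_besovNorm_le s
  obtain ⟨S, hS⟩ := exists_seqNorm_le_of_le_two_rpow (zero_lt_one.trans_le hq).ne' hη
  refine ⟨C * S, fun B f A a J hB hf hA => (hC B f hB hf p q hq).trans ?_⟩
  rw [ENNReal.coe_mul, mul_assoc]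
  gcongr
  exact hS _ A a J hA

theorem IsLittlewoodPaley.exists_hasSum_of_lpProj_eq_add (hφ : IsLittlewoodPaley φ)
    {g : VectorDistribution d} (hg : HasSum (fun j => lpProj φ j g) g)
    {h b : ℤ → VectorDistribution d} (hsplit : ∀ j, lpProj φ j g = h j + b j)
    (hh : ∀ j, IsDyadicBlock φ j (h j)) {p : ℝ≥0∞} [Fact (1 ≤ p)]
    (hp : ∑' j, distLpNorm p (h j) < ∞) :
    ∃ gt gb, g = gt + gb ∧ HasSum h gt ∧ HasSum b gb ∧
      HasSum (fun j => lpProj φ j gt) gt ∧ HasSum (fun j => lpProj φ j gb) gb ∧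
      distLpNorm p gt ≤ ∑' j, distLpNorm p (h j) := by
  obtain ⟨gt, hgt, hgt_le⟩ := exists_hasSum_distLpNorm_le_tsum hp
  have hgt_lp := hφ.hasSum_lpProj_of_hasSum hh hgt hp
  refine ⟨gt, g - gt, (add_sub_cancel gt g).symm, hgt, ?_, hgt_lp, ?_, hgt_le⟩
  · simpa only [hsplit, add_sub_cancel_left] using hg.sub hgt
  · simpa only [lpProj_eq_dyadicMul, map_sub] using hg.sub hgt_lp

theorem exists_gt_mul_lt {a b c : ℝ} (hb : 0 ≤ b) (h : a * b < c) : ∃ x, a < x ∧ x * b < c := by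
  have hε : 0 < (c - a * b) / (b + 1) := div_pos (sub_pos.2 h) (by positivity)
  have hε' : (c - a * b) / (b + 1) * (b + 1) = c - a * b := div_mul_cancel₀ _ (by positivity)
  exact ⟨a + (c - a * b) / (b + 1), by linarith, by linarith⟩

theorem IsLittlewoodPaley.exists_decomposition (hφ : IsLittlewoodPaley φ) {p q δ : ℝ}
    (hp : 2 ≤ p) (hpq : p < q) (hδ : 0 < δ) (hδ' : δ / (1 - p / q) * (p - 2) < d - 2) :
    ∃ K : ℝ≥0, ∀ g : VectorDistribution d, IsRealValued g → IsDivFree g →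
      MemBesov φ (critReg d p) (ENNReal.ofReal p) ∞ g → ∀ J : ℤ,
      ∃ gt gb : VectorDistribution d, g = gt + gb ∧
        IsRealValued gt ∧ IsRealValued gb ∧ IsDivFree gt ∧ IsDivFree gb ∧
        HasSum (fun j => lpProj φ j gt) gt ∧ HasSum (fun j => lpProj φ j gb) gb ∧
        distLpNorm 2 gt ≤
          K * besovNorm φ (critReg d p) (ENNReal.ofReal p) ∞ g * 2 ^ (-((d / 2 - 1 : ℝ) * J)) ∧
        besovNorm φ (critReg d q + δ) (ENNReal.ofReal q) (ENNReal.ofReal q) gb ≤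
          K * besovNorm φ (critReg d p) (ENNReal.ofReal p) ∞ g * 2 ^ (δ * J) ∧
        besovNorm φ (critReg d p) (ENNReal.ofReal p) ∞ gt ≤
          K * besovNorm φ (critReg d p) (ENNReal.ofReal p) ∞ g ∧
        besovNorm φ (critReg d p) (ENNReal.ofReal p) ∞ gb ≤
          K * besovNorm φ (critReg d p) (ENNReal.ofReal p) ∞ g := by
  have : Fact (1 ≤ ENNReal.ofReal p) := ⟨ENNReal.one_le_ofReal.2 (by linarith)⟩
  have hq1 : 1 ≤ ENNReal.ofReal q := ENNReal.one_le_ofReal.2 (by linarith)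
  have : Fact (1 ≤ ENNReal.ofReal q) := ⟨hq1⟩
  have hθ : 0 < 1 - p / q := sub_pos.2 ((div_lt_one (by linarith)).2 hpq)
  obtain ⟨κ, hκδ, hκd⟩ := exists_gt_mul_lt (sub_nonneg.2 hp) hδ'
  have hη : 0 < min δ (κ * (1 - p / q) - δ) :=
    lt_min hδ (sub_pos.2 ((div_lt_iff₀ hθ).1 hκδ))
  have hη' : 0 < (d / 2 - 1 - κ * (p / 2 - 1) : ℝ) := by linarith
  obtain ⟨K, hK⟩ := hφ.exists_solenoidal_split (κ := κ) hp hpq.le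
    (min_le_left δ (κ * (1 - p / q) - δ)) (min_le_right δ (κ * (1 - p / q) - δ))
  obtain ⟨S, hS⟩ := exists_seqNorm_le_of_le_two_rpow one_ne_zero hη'
  obtain ⟨C, hC⟩ := hφ.exists_besovNorm_top_le (critReg d p) (ENNReal.ofReal p)
  obtain ⟨D, hD⟩ :=
    hφ.exists_besovNorm_le_of_le_two_rpow (critReg d q + δ) (ENNReal.ofReal q) hq1 hη
  refine ⟨(S + C + D) * K, fun g hgr hgd ⟨hg, hgsum⟩ J => ?_⟩
  choose h b hsplit hh hb hhp hbp hh2 hbq using hK g hgr hgd hg J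
  set M := besovNorm φ (critReg d p) (ENNReal.ofReal p) ∞ g
  have hKM : K * M ≠ ∞ := ENNReal.mul_ne_top ENNReal.coe_ne_top hg.ne
  have hh2_sum := seqNorm_one _ ▸ hS _ _ _ _ hh2
  have hh2_lt := hh2_sum.trans_lt <| ENNReal.mul_lt_top ENNReal.coe_lt_top <|
    mul_comm (K * M) _ ▸ two_rpow_mul_lt_top _ hKM
  obtain ⟨gt, gb, hg_eq, hgt, hgb, hgt_lp, hgb_lp, hgt_le⟩ :=
    hφ.exists_hasSum_of_lpProj_eq_add hgsum hsplit (fun j => (hh j).toIsDyadicBlock) hh2_lt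
  simp only [ENNReal.coe_mul, ENNReal.coe_add, mul_assoc _ (K : ℝ≥0∞) M, mul_assoc _ (K * M)]
  refine ⟨gt, gb, hg_eq, .of_hasSum hgt fun j => (hh j).isRealValued,
    .of_hasSum hgb fun j => (hb j).isRealValued, .of_hasSum hgt fun j => (hh j).isDivFree,
    .of_hasSum hgb fun j => (hb j).isDivFree, hgt_lp, hgb_lp, ?_, ?_, ?_, ?_⟩
  · refine (hgt_le.trans hh2_sum).trans ?_
    gcongr
    exact le_self_add.trans le_self_add
  · refine (hD b gb _ _ J (fun j => (hb j).toIsDyadicBlock) hgb hbq).trans ?_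
    gcongr
    exact le_add_self
  · refine (hC h gt _ (fun j => (hh j).toIsDyadicBlock) hgt hhp).trans ?_
    gcongr
    exact le_add_self.trans le_self_add
  · refine (hC b gb _ (fun j => (hb j).toIsDyadicBlock) hgb hbp).trans ?_
    gcongr
    exact le_add_self.trans le_self_add

theorem one_div_mul_add_lt_neg_critReg {p : ℝ} (hp : 1 < p) :
    1 / (p * (p + d)) < -critReg d (p + d) := by
  have hcrit : -critReg d (p + d) = p * p / (p * (p + d)) := by
    rw [critReg]
    field_simp
    ring
  rw [hcrit]
  gcongr
  nlinarith

theorem one_div_mul_add_div_mul_lt {p D : ℝ} (hp : 2 ≤ p) (hD : 3 ≤ D) :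
    1 / (p * (p + D)) / (1 - p / (p + D)) * (p - 2) < D - 2 := by
  have hlhs : 1 / (p * (p + D)) / (1 - p / (p + D)) * (p - 2) = (p - 2) / (p * D) := by
    rw [one_sub_div (by positivity), add_sub_cancel_left]
    field_simp
  rw [hlhs, div_lt_iff₀ (by positivity)]
  nlinarith [mul_pos (by linarith : 0 < p) (by linarith : 0 < D - 2)]

theorem exists_int_two_rpow_le {N : ℝ} (hN : 0 < N) {γ δ : ℝ} (hγ : 0 ≤ γ) (hδ : 0 ≤ δ) :
    ∃ J : ℤ, (2 : ℝ) ^ (-(γ * J)) ≤ 2 ^ γ * N ^ (-γ) ∧ (2 : ℝ) ^ (δ * J) ≤ N ^ δ := by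
  obtain ⟨J, hJN, hNJ⟩ := exists_mem_Ico_zpow hN one_lt_two
  refine ⟨J, ?_, ?_⟩
  · calc (2 : ℝ) ^ (-(γ * J))
        = 2 ^ γ * ((2 : ℝ) ^ (J + 1)) ^ (-γ) := by
          rw [← Real.rpow_intCast, ← Real.rpow_mul zero_le_two, ← Real.rpow_add two_pos]
          push_cast
          ring_nf
      _ ≤ 2 ^ γ * N ^ (-γ) := by
          exact mul_le_mul_of_nonneg_left
            (Real.rpow_le_rpow_of_nonpos hN hNJ.le (neg_nonpos.2 hγ)) (by positivity)
  · calc (2 : ℝ) ^ (δ * J) = ((2 : ℝ) ^ J) ^ δ := by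
          rw [← Real.rpow_intCast, ← Real.rpow_mul zero_le_two, mul_comm]
      _ ≤ N ^ δ := by gcongr

theorem coe_mul_mul_two_rpow_le {K : ℝ≥0} (M : ℝ≥0∞) {x y : ℝ} (h : K * 2 ^ x ≤ y) :
    K * M * 2 ^ x ≤ ENNReal.ofReal y * M := by
  calc K * M * 2 ^ x = ENNReal.ofReal (K * 2 ^ x) * M := by
        rw [ENNReal.ofReal_mul K.coe_nonneg, ENNReal.ofReal_coe_nnreal,
          ← ENNReal.ofReal_rpow_of_pos two_pos, ENNReal.ofReal_ofNat]
        ring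
    _ ≤ ENNReal.ofReal y * M := by gcongr

end Decomposition

theorem lemma1p5_general (d : ℕ) (hd : 3 ≤ d) (p : ℝ) (hp : 2 ≤ p) :
    ∃ p₂ δ₂ γ₁ γ₂ : ℝ, p < p₂ ∧ 0 < δ₂ ∧ δ₂ < -critReg d p₂ ∧ 0 < γ₁ ∧ 0 < γ₂ ∧
      ∀ φ : EuclideanSpace ℝ (Fin d) → ℝ, IsLittlewoodPaley φ →
      ∃ C : ℝ, 0 < C ∧
      ∀ g : VectorDistribution d, IsRealValued g → IsDivFree g →
        MemBesov φ (critReg d p) (ENNReal.ofReal p) ∞ g →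
      ∀ N : ℝ, 0 < N →
      ∃ gt gb : VectorDistribution d,
        IsRealValued gt ∧ IsRealValued gb ∧ IsDivFree gt ∧ IsDivFree gb ∧
        distLpNorm 2 gt < ∞ ∧
        MemBesov φ (critReg d p) (ENNReal.ofReal p) ∞ gt ∧
        MemBesov φ (critReg d p₂ + δ₂) (ENNReal.ofReal p₂) (ENNReal.ofReal p₂) gb ∧
        MemBesov φ (critReg d p) (ENNReal.ofReal p) ∞ gb ∧
        g = gt + gb ∧
        distLpNorm 2 gt ≤
          ENNReal.ofReal (C * N ^ (-γ₂)) * besovNorm φ (critReg d p) (ENNReal.ofReal p) ∞ g ∧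
        besovNorm φ (critReg d p₂ + δ₂) (ENNReal.ofReal p₂) (ENNReal.ofReal p₂) gb ≤
          ENNReal.ofReal (C * N ^ γ₁) * besovNorm φ (critReg d p) (ENNReal.ofReal p) ∞ g ∧
        besovNorm φ (critReg d p) (ENNReal.ofReal p) ∞ gt ≤
          ENNReal.ofReal C * besovNorm φ (critReg d p) (ENNReal.ofReal p) ∞ g ∧
        besovNorm φ (critReg d p) (ENNReal.ofReal p) ∞ gb ≤
          ENNReal.ofReal C * besovNorm φ (critReg d p) (ENNReal.ofReal p) ∞ g := by
  have hd' : (3 : ℝ) ≤ d := by exact_mod_cast hd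
  have hγ : (0 : ℝ) < d / 2 - 1 := by linarith
  have hδ : 0 < 1 / (p * (p + d)) := by positivity
  refine ⟨p + d, 1 / (p * (p + d)), 1 / (p * (p + d)), d / 2 - 1, by linarith, hδ,
    one_div_mul_add_lt_neg_critReg (by linarith), hδ, hγ, fun φ hφ => ?_⟩
  obtain ⟨K, hK⟩ := hφ.exists_decomposition hp (lt_add_of_pos_right p (by linarith)) hδ
    (one_div_mul_add_div_mul_lt hp hd')
  have h2γ : (1 : ℝ) ≤ 2 ^ (d / 2 - 1 : ℝ) := Real.one_le_rpow one_le_two hγ.le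
  have hKC : (K : ℝ) ≤ (K + 1) * 2 ^ (d / 2 - 1 : ℝ) := by nlinarith [K.coe_nonneg]
  have hKC' : (K : ℝ≥0∞) ≤ ENNReal.ofReal ((K + 1) * 2 ^ (d / 2 - 1 : ℝ)) :=
    ENNReal.ofReal_coe_nnreal ▸ ENNReal.ofReal_le_ofReal hKC
  refine ⟨(K + 1) * 2 ^ (d / 2 - 1 : ℝ), by positivity, fun g hgr hgd hg N hN => ?_⟩
  obtain ⟨J, hJt, hJb⟩ := exists_int_two_rpow_le hN hγ.le hδ.le
  obtain ⟨gt, gb, hsum, htr, hbr, htd, hbd, hts, hbs, ht2, hbq, htp, hbp⟩ := hK g hgr hgd hg J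
  replace ht2 := ht2.trans (coe_mul_mul_two_rpow_le _ (y := (K + 1) * 2 ^ (d / 2 - 1 : ℝ) *
    N ^ (-(d / 2 - 1 : ℝ))) (by rw [mul_assoc]; gcongr; linarith))
  replace hbq := hbq.trans (coe_mul_mul_two_rpow_le _ (mul_le_mul hKC hJb (by positivity)
    (by positivity)))
  replace htp := htp.trans (mul_le_mul_left hKC' _)
  replace hbp := hbp.trans (mul_le_mul_left hKC' _)
  have hlt (x : ℝ) := ENNReal.mul_lt_top (ENNReal.ofReal_lt_top (r := x)) hg.1
  exact ⟨gt, gb, htr, hbr, htd, hbd, ht2.trans_lt (hlt _), ⟨htp.trans_lt (hlt _), hts⟩,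
    ⟨hbq.trans_lt (hlt _), hbs⟩, ⟨hbp.trans_lt (hlt _), hbs⟩, hsum, ht2, hbq, htp, hbp⟩

theorem lemma1p5 (d : ℕ) (hd : 3 ≤ d) (p : ℝ) (hp : (d : ℝ) < p) :
    ∃ p₂ δ₂ γ₁ γ₂ : ℝ, p < p₂ ∧ 0 < δ₂ ∧ δ₂ < -critReg d p₂ ∧ 0 < γ₁ ∧ 0 < γ₂ ∧
      ∀ φ : EuclideanSpace ℝ (Fin d) → ℝ, IsLittlewoodPaley φ →
      ∃ C : ℝ, 0 < C ∧
      ∀ g : VectorDistribution d, IsRealValued g → IsDivFree g →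
        MemBesov φ (critReg d p) (ENNReal.ofReal p) ∞ g →
      ∀ N : ℝ, 0 < N →
      ∃ gt gb : VectorDistribution d,
        IsRealValued gt ∧ IsRealValued gb ∧ IsDivFree gt ∧ IsDivFree gb ∧
        distLpNorm 2 gt < ∞ ∧
        MemBesov φ (critReg d p) (ENNReal.ofReal p) ∞ gt ∧
        MemBesov φ (critReg d p₂ + δ₂) (ENNReal.ofReal p₂) (ENNReal.ofReal p₂) gb ∧
        MemBesov φ (critReg d p) (ENNReal.ofReal p) ∞ gb ∧
        g = gt + gb ∧
        distLpNorm 2 gt ≤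
          ENNReal.ofReal (C * N ^ (-γ₂)) * besovNorm φ (critReg d p) (ENNReal.ofReal p) ∞ g ∧
        besovNorm φ (critReg d p₂ + δ₂) (ENNReal.ofReal p₂) (ENNReal.ofReal p₂) gb ≤
          ENNReal.ofReal (C * N ^ γ₁) * besovNorm φ (critReg d p) (ENNReal.ofReal p) ∞ g ∧
        besovNorm φ (critReg d p) (ENNReal.ofReal p) ∞ gt ≤
          ENNReal.ofReal C * besovNorm φ (critReg d p) (ENNReal.ofReal p) ∞ g ∧
        besovNorm φ (critReg d p) (ENNReal.ofReal p) ∞ gb ≤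
          ENNReal.ofReal C * besovNorm φ (critReg d p) (ENNReal.ofReal p) ∞ g :=
  lemma1p5_general d hd p (by linarith [show (3 : ℝ) ≤ d by exact_mod_cast hd])
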